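/- Let $X$ be an infinite compact metric space, let $h\colon X\to X$ be a minimal homeomorphism, let $D$ be a simple unital C*-algebra which has a tracial state, and let $\alpha\in\mathrm{Aut}(C(X,D))$ lie over $h$; that is, there are $\alpha_{n,x}\in\mathrm{Aut}(D)$, for $n\in\mathbb{Z}$ and $x\in X$, such that $\alpha^n(a)(x)=\alpha_{n,x}\bigl(a(h^{-n}(x))\bigr)$ for all $n\in\mathbb{Z}$, $x\in X$, $a\in C(X,D)$. Assume that the action of $\mathbb{Z}$ generated by $\alpha$ is pseudoperiodically generated: for every $a\in D_+\setminus\{0\}$ there is $b\in D_+\setminus\{0\}$ such that $b\precsim_D \sigma(a)$ for every $\sigma\in\{\alpha_{n,x}: n\in\mathbb{Z},\,x\in X\}\cup\{\mathrm{id}_D\}$. Here, for a C*-algebra $B$, a C*-algebra $A\supseteq B$ and $a,b\in A$, $a\precsim_B b$ means that there are $v_1,v_2,\ldots\in B$ with $\lim_{k\to\infty} v_k b v_k^*=a$ (Cuntz subequivalence). Let $Y\subset X$ be a compact subset such that $h^n(Y)\cap Y=\varnothing$ for all $n\in\mathbb{Z}\setminus\{0\}$. Let $A=C^*(\mathbb{Z},C(X,D),\alpha)$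 be the crossed product, with canonical unitary $u$, so that $u f u^*=\alpha(f)$ for $f\in C(X,D)\subset A$, and let $B=C^*(\mathbb{Z},C(X,D),\alpha)_Y\subset A$ be the $Y$-orbit breaking subalgebra, that is, the C*-subalgebra of $A$ generated by $C(X,D)$ and all $f u$ with $f\in C(X,D)$ and $f|_Y=0$. Then $B$ is a large subalgebra of $A$ of crossed product type. That is, $A$ is simple, unital and infinite dimensional, and there are a C*-subalgebra $C\subset B$ and a subset $G$ of the unitary group of $A$ such that: (1) (a) $1_A\in C$; (b) $C$ and $G$ generate $A$ as a C*-algebra; (c) $wCw^*\subset C$ and $w^*Cw\subset C$ for all $w\in G$. (2) For all $m\in\mathbb{Z}_{>0}$, $a_1,\ldots,a_m\in A$, $\varepsilon>0$, $x\in A_+$ with $\|x\|=1$, and $y\in B_+\setminus\{0\}$, there are $c_1,\ldots,c_m\in A$ and $g\in C$ such that: (a) $0\le g\le 1$; (b) $\|c_j-a_j\|<\varepsilon$ for all $j$; (c) $(1-g)c_j\in B$ for all $j$; (d) $g\precsim_B y$ and $g\precsim_A x$; (e) $\|(1-g)x(1-g)\|>1-\varepsilon$. -/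

import Mathlib

open scoped ENNReal ComplexOrder

/-! ### Elementary notions for unital C*-algebras -/

/-- `a` is a positive element of the C*-algebra `A`. -/
def IsPosElem {A : Type*} [CStarAlgebra A] (a : A) : Prop :=
  ∃ s : A, a = star s * s

/-- `A` is a simple C*-algebra: it is nonzero, and its only closed two-sided ideals are
zero and `A`. -/
def IsSimpleCStar (A : Type*) [CStarAlgebra A] : Prop :=
  Nontrivial A ∧ ∀ I : TwoSidedIdeal A, IsClosed {a : A | a ∈ I} → I = ⊥ ∨ I = ⊤

/-- `D` has a tracial state. -/
def HasTracialState (D : Type*) [CStarAlgebra D] : Prop :=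
  ∃ τ : D →ₗ[ℂ] ℂ, (∀ a : D, 0 ≤ τ (star a * a)) ∧ τ 1 = 1 ∧ ∀ a b : D, τ (a * b) = τ (b * a)

/-- Cuntz subequivalence `a ≾ b` over the subalgebra `B`: there is a sequence `v` in `B`
with `v n * b * (v n)* → a`. -/
def CuntzSubeq {A : Type*} [CStarAlgebra A] (B : StarSubalgebra ℂ A) (a b : A) : Prop :=
  ∃ v : ℕ → A, (∀ n, v n ∈ B) ∧
    Filter.Tendsto (fun n => v n * b * star (v n)) Filter.atTop (nhds a)

/-- The C*-subalgebra of `A` generated by `1` and the set `S`. -/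
noncomputable def cstarGenerated {A : Type*} [CStarAlgebra A] (S : Set A) : StarSubalgebra ℂ A :=
  (StarAlgebra.adjoin ℂ S).topologicalClosure

/-- `B` is a large subalgebra of `A` of crossed product type. The requirement that `A` be simple,
unital and infinite dimensional is part of the notion. -/
def IsLargeOfCrossedProductType {A : Type*} [CStarAlgebra A] (B : StarSubalgebra ℂ A) : Prop :=
  IsSimpleCStar A ∧ ¬ FiniteDimensional ℂ A ∧ IsClosed (B : Set A) ∧
  ∃ (C : StarSubalgebra ℂ A) (G : Set A),
    IsClosed (C : Set A) ∧ C ≤ B ∧ G ⊆ (unitary A : Set A) ∧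
    cstarGenerated ((C : Set A) ∪ G) = ⊤ ∧
    (∀ u ∈ G, ∀ c ∈ C, u * c * star u ∈ C ∧ star u * c * u ∈ C) ∧
    ∀ (m : ℕ) (a : Fin m → A) (ε : ℝ) (x y : A),
      0 < m → 0 < ε → IsPosElem x → ‖x‖ = 1 → y ∈ B → IsPosElem y → y ≠ 0 →
      ∃ (c : Fin m → A) (g : A), g ∈ C ∧
        IsPosElem g ∧ IsPosElem (1 - g) ∧
        (∀ j, ‖c j - a j‖ < ε) ∧
        (∀ j, (1 - g) * c j ∈ B) ∧
        CuntzSubeq B g y ∧ CuntzSubeq ⊤ g x ∧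
        1 - ε < ‖(1 - g) * x * (1 - g)‖

/-! ### Crossed products by the integers -/

universe w

/-- A covariant pair for the action of `ℤ` on `A` generated by `α`: a nonzero unital C*-algebra
`E` with a unital *-homomorphism `φ : A → E` and a unitary `u ∈ E` such that
`u φ(a) u* = φ(α(a))`. -/
structure CovariantPair {A : Type w} [CStarAlgebra A] (α : A ≃⋆ₐ[ℂ] A) where
  /-- the target algebra -/
  E : Type w
  [cstar : CStarAlgebra E]
  [nontriv : Nontrivial E]
  /-- the homomorphism on the coefficient algebra -/
  φ : A →⋆ₐ[ℂ] E
  /-- the unitary implementing the automorphism -/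
  u : E
  unitary_u : u ∈ unitary E
  covariant : ∀ a : A, u * φ a * star u = φ (α a)

attribute [instance] CovariantPair.cstar CovariantPair.nontriv

namespace CovariantPair

variable {A : Type w} [CStarAlgebra A] (α : A ≃⋆ₐ[ℂ] A)

/-- The product, over all covariant pairs, of the target C*-algebras: all bounded families, with
the supremum norm. -/
abbrev Prod : Type (w + 1) := lp (fun i : CovariantPair α => i.E) ∞

noncomputable instance : CStarAlgebra (Prod α) where

/-- The universal homomorphism `a ↦ (φ(a))` over all covariant pairs. -/
noncomputable def coeff (a : A) : Prod α :=
  ⟨fun i => i.φ a, memℓp_infty ⟨‖a‖, by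
    rintro _ ⟨i, rfl⟩
    exact NonUnitalStarAlgHom.norm_apply_le i.φ a⟩⟩

/-- The universal unitary, the family of the unitaries of all covariant pairs. -/
noncomputable def unit : Prod α :=
  ⟨fun i => i.u, memℓp_infty ⟨1, by
    rintro _ ⟨i, rfl⟩
    exact (CStarRing.norm_of_mem_unitary i.unitary_u).le⟩⟩

/-- The C*-algebra generated by the universal covariant pair. -/
noncomputable def algebra : StarSubalgebra ℂ (Prod α) :=
  cstarGenerated (Set.range (coeff α) ∪ {unit α})

end CovariantPair

section CrossedProduct

variable {A : Type w} [CStarAlgebra A] (α : A ≃⋆ₐ[ℂ] A)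

/-- The crossed product C*-algebra `C*(ℤ, A, α)`: the C*-algebra generated by a universal
covariant pair. Its norm on `∑ aₙ uⁿ` is the supremum of `‖∑ φ(aₙ) uⁿ‖` over all covariant
pairs. -/
def CrossedProduct : Type (w + 1) := CovariantPair.algebra α

noncomputable instance : CStarAlgebra (CrossedProduct α) :=
  haveI : IsClosed (CovariantPair.algebra α : Set (CovariantPair.Prod α)) :=
    StarSubalgebra.isClosed_topologicalClosure _
  inferInstanceAs (CStarAlgebra (CovariantPair.algebra α))

/-- The canonical map `A → C*(ℤ, A, α)`. -/
noncomputable def CrossedProduct.ι (a : A) : CrossedProduct α :=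
  ⟨CovariantPair.coeff α a, StarSubalgebra.le_topologicalClosure _
    (StarAlgebra.subset_adjoin ℂ _ (Or.inl ⟨a, rfl⟩))⟩

/-- The canonical unitary `u ∈ C*(ℤ, A, α)` corresponding to `1 ∈ ℤ`. -/
noncomputable def CrossedProduct.u : CrossedProduct α :=
  ⟨CovariantPair.unit α, StarSubalgebra.le_topologicalClosure _
    (StarAlgebra.subset_adjoin ℂ _ (Or.inr rfl))⟩

end CrossedProduct

/-! ### Automorphisms of `C(X, D)` over a homeomorphism -/

section Over

variable {X : Type*} [TopologicalSpace X] {D : Type*} [CStarAlgebra D]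

/-- `h` is a minimal homeomorphism: it has no closed invariant subsets other than `∅` and `X`. -/
def IsMinimalHomeo (h : X ≃ₜ X) : Prop :=
  ∀ F : Set X, IsClosed F → h '' F = F → F = ∅ ∨ F = Set.univ

/-- A set `S` of automorphisms of `D` is pseudoperiodic. -/
def IsPseudoperiodic (S : Set (D ≃⋆ₐ[ℂ] D)) : Prop :=
  ∀ a : D, IsPosElem a → a ≠ 0 → ∃ b : D, IsPosElem b ∧ b ≠ 0 ∧
    ∀ σ ∈ S ∪ {1}, CuntzSubeq ⊤ b (σ a)

variable [CompactSpace X]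

/-- `β` is a family of automorphisms of `D` through which the action `n ↦ αⁿ` of `ℤ` on `C(X, D)`
lies over the action `n ↦ hⁿ` on `X`: `αⁿ(a)(x) = β n x (a (h⁻ⁿ x))`. -/
def IsFiberFamily (h : X ≃ₜ X) (α : C(X, D) ≃⋆ₐ[ℂ] C(X, D)) (β : ℤ → X → (D ≃⋆ₐ[ℂ] D)) : Prop :=
  ∀ (n : ℤ) (x : X) (a : C(X, D)), (α ^ n) a x = β n x (a ((h ^ (-n)) x))

/-- The automorphism `α` of `C(X, D)` lies over the homeomorphism `h`. -/
def LiesOver (h : X ≃ₜ X) (α : C(X, D) ≃⋆ₐ[ℂ] C(X, D)) : Prop :=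
  ∃ β : ℤ → X → (D ≃⋆ₐ[ℂ] D), IsFiberFamily h α β

/-- The action of `ℤ` generated by `α` (which lies over `h`) is pseudoperiodically generated. The
family `β` is unique when `D ≠ 0`. -/
def IsPseudoperiodicallyGenerated (h : X ≃ₜ X) (α : C(X, D) ≃⋆ₐ[ℂ] C(X, D)) : Prop :=
  ∃ β : ℤ → X → (D ≃⋆ₐ[ℂ] D), IsFiberFamily h α β ∧
    IsPseudoperiodic {σ | ∃ (n : ℤ) (x : X), σ = β n x}

/-- The `Y`-orbit breaking subalgebra `C*(ℤ, C(X, D), α)_Y`, generated by `C(X, D)` and the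
elements `f u` with `f ∈ C(X, D)` vanishing on `Y`. -/
noncomputable def orbitBreaking (α : C(X, D) ≃⋆ₐ[ℂ] C(X, D)) (Y : Set X) :
    StarSubalgebra ℂ (CrossedProduct α) :=
  cstarGenerated (Set.range (CrossedProduct.ι α) ∪
    {b | ∃ f : C(X, D), (∀ y ∈ Y, f y = 0) ∧ b = CrossedProduct.ι α f * CrossedProduct.u α})

end Over

/-! ### Positive elements and Cuntz subequivalence -/

section Positive

variable {A : Type*} [CStarAlgebra A]

/-! Take `C` to be the image of `C(X, D)` and `G = {u}`. Approximate each `a_j` by a finite sum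
`c_j` of terms `f uⁿ`. A nonnegative scalar function multiplies such a sum into `B` once it vanishes
on enough translates of `Y`, because `f uⁿ` then factors through generators of `B`
(`Breaks.scalar_mul_pow_mem`). So `g` is sought as a scalar function equal to `1` on `hʲ(Y)` for `-N
≤ j < N`. It must also be Cuntz-small and must hardly affect the norm of `x`.

Smallness. By Baire, some orbit, that of `x₀`, misses `Y`. Three comparisons are chained. (i) `g ≾
G` over `B`, for a bump function `G` at `x₀` (`Breaks.exists_scalar_cuntzSubeq`): a neighbourhood of
the translates of `Y` is cut into pieces. Each piece moves away from `Y` in time until it enters the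
region where `G = 1`, and arrival times are arranged so that no two pieces collide. (ii) `G ≾ φ ⊗ a`
if `G` is supported close enough to `x₀` (`Breaks.exists_nhd_scalar_cuntzSubeq`): the orbit of `x₀`
visits the support of `φ` as often as desired. Pseudoperiodicity supplies one `b` below every `β n x
a`, and finitely many conjugates of `b` sum to at least `1`. (iii) `φ ⊗ a ≾ y` for some nonzero `φ ⊗
a` (`HasCoeffs.exists_cuntzSubeq`): averaging over the gauge action gives a faithful expectation,
hence a nonzero coefficient `p`. Cutting `y` down by a function with small support leaves nearly a
multiple of a value of `p`.

Simplicity of `A` follows from (ii) and (iii): a nonzero closed ideal contains some `φ ⊗ a`, then a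
bump function, then a sum of its translates that is invertible.

Norm. In the representation on `ℓ²(ℤ, H)` induced from the point `x₀`, the function `g` acts on
coordinate `n` by `g(hⁿ x₀)`. If `g` vanishes at finitely many suitable points of the orbit, `1 - g`
almost fixes a nearly norming vector and its image. Simplicity makes this representation isometric.
-/

theorem isPosElem_iff_nonneg [PartialOrder A] [StarOrderedRing A] {a : A} :
    IsPosElem a ↔ 0 ≤ a :=
  CStarAlgebra.nonneg_iff_eq_star_mul_self.symm

theorem isPosElem_star_mul_self (a : A) : IsPosElem (star a * a) := ⟨a, rfl⟩

theorem IsPosElem.star_eq {a : A} (ha : IsPosElem a) : star a = a := by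
  obtain ⟨s, rfl⟩ := ha
  simp

theorem IsPosElem.conj {a : A} (ha : IsPosElem a) (v : A) : IsPosElem (v * a * star v) := by
  obtain ⟨s, rfl⟩ := ha
  exact ⟨s * star v, by simp [mul_assoc]⟩

theorem IsPosElem.add {a b : A} (ha : IsPosElem a) (hb : IsPosElem b) : IsPosElem (a + b) := by
  let := CStarAlgebra.spectralOrder A
  have := CStarAlgebra.spectralOrderedRing A
  rw [isPosElem_iff_nonneg] at *
  exact add_nonneg ha hb

theorem isPosElem_zero : IsPosElem (0 : A) := ⟨0, by simp⟩

theorem IsPosElem.smul {a : A} (ha : IsPosElem a) {r : ℝ} (hr : 0 ≤ r) : IsPosElem (r • a) := by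
  let := CStarAlgebra.spectralOrder A
  have := CStarAlgebra.spectralOrderedRing A
  rw [isPosElem_iff_nonneg] at *
  exact smul_nonneg hr ha

theorem IsPosElem.map {B : Type*} [CStarAlgebra B] {a : A} (ha : IsPosElem a)
    (f : A →⋆ₐ[ℂ] B) : IsPosElem (f a) := by
  obtain ⟨s, rfl⟩ := ha
  exact ⟨f s, by rw [map_mul, map_star]⟩

/-- An injective star homomorphism reflects positivity. -/
theorem IsPosElem.of_map {B : Type*} [CStarAlgebra B] {a : A} (f : A →⋆ₐ[ℂ] B)
    (hf : Function.Injective f) (ha : IsPosElem (f a)) : IsPosElem a := by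
  let := CStarAlgebra.spectralOrder A
  have := CStarAlgebra.spectralOrderedRing A
  let := CStarAlgebra.spectralOrder B
  have := CStarAlgebra.spectralOrderedRing B
  have hsa : IsSelfAdjoint a := hf (by rw [map_star, ha.star_eq])
  rw [isPosElem_iff_nonneg] at *
  rw [StarOrderedRing.nonneg_iff_spectrum_nonneg (R := ℝ) _ hsa]
  rw [StarOrderedRing.nonneg_iff_spectrum_nonneg (R := ℝ) _ (hsa.map f)] at ha
  rwa [hsa.map_spectrum_real f hf] at ha

theorem isPosElem_add_of_norm_le {a : A} (ha : star a = a) {r : ℝ} (hr : ‖a‖ ≤ r) :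
    IsPosElem (a + r • (1 : A)) := by
  let := CStarAlgebra.spectralOrder A
  have := CStarAlgebra.spectralOrderedRing A
  rw [isPosElem_iff_nonneg]
  have h1 := IsSelfAdjoint.neg_algebraMap_norm_le_self (a := a) ha
  have h2 : (algebraMap ℝ A ‖a‖) ≤ algebraMap ℝ A r := by
    rw [← sub_nonneg, ← map_sub, Algebra.algebraMap_eq_smul_one]
    exact smul_nonneg (sub_nonneg.2 hr) zero_le_one
  rw [← Algebra.algebraMap_eq_smul_one]
  have := neg_le_iff_add_nonneg.1 h1
  calc (0 : A) ≤ a + algebraMap ℝ A ‖a‖ := this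
    _ ≤ _ := by gcongr

theorem IsPosElem.exists_sqrt {a : A} (ha : IsPosElem a) :
    ∃ s : A, star s = s ∧ s * s = a ∧
      ∀ B : StarSubalgebra ℂ A, IsClosed (B : Set A) → a ∈ B → s ∈ B := by
  let := CStarAlgebra.spectralOrder A
  have := CStarAlgebra.spectralOrderedRing A
  rw [isPosElem_iff_nonneg] at ha
  refine ⟨cfc Real.sqrt a, ?_, ?_, fun B hB haB => ?_⟩
  · exact (cfc_predicate Real.sqrt a : IsSelfAdjoint _).star_eq
  · rw [← cfc_mul Real.sqrt Real.sqrt a]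
    conv_rhs => rw [← cfc_id' ℝ a]
    exact cfc_congr fun x hx => Real.mul_self_sqrt (spectrum_nonneg_of_nonneg ha hx)
  · have := hB
    exact cfc_mem _ haB

end Positive

section Cuntz

variable {A : Type*} [CStarAlgebra A] {B : StarSubalgebra ℂ A} {a b c : A}

theorem cuntzSubeq_of_forall_pos (h : ∀ ε : ℝ, 0 < ε → ∃ v ∈ B, ‖v * b * star v - a‖ < ε) :
    CuntzSubeq B a b := by
  choose v hv hva using fun n : ℕ => h (1 / ((n : ℝ) + 1)) Nat.one_div_pos_of_nat
  refine ⟨v, hv, ?_⟩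
  rw [tendsto_iff_norm_sub_tendsto_zero]
  exact squeeze_zero (fun _ => norm_nonneg _) (fun n => (hva n).le)
    tendsto_one_div_add_atTop_nhds_zero_nat

theorem CuntzSubeq.exists_norm_lt (h : CuntzSubeq B a b) {ε : ℝ} (hε : 0 < ε) :
    ∃ v ∈ B, ‖v * b * star v - a‖ < ε := by
  obtain ⟨v, hv, ht⟩ := h
  rw [tendsto_iff_norm_sub_tendsto_zero] at ht
  obtain ⟨n, hn⟩ := (ht.eventually_lt_const hε).exists
  exact ⟨v n, hv n, hn⟩

theorem cuntzSubeq_conj {v : A} (hv : v ∈ B) (b : A) : CuntzSubeq B (v * b * star v) b :=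
  ⟨fun _ => v, fun _ => hv, tendsto_const_nhds⟩

theorem CuntzSubeq.trans (hab : CuntzSubeq B a b) (hbc : CuntzSubeq B b c) :
    CuntzSubeq B a c := by
  refine cuntzSubeq_of_forall_pos fun ε hε => ?_
  obtain ⟨v, hv, hva⟩ := hab.exists_norm_lt (half_pos hε)
  obtain ⟨w, hw, hwb⟩ := hbc.exists_norm_lt
    (show 0 < ε / (2 * (‖v‖ * ‖v‖ + 1)) by positivity)
  refine ⟨v * w, mul_mem hv hw, ?_⟩
  have e : v * w * c * star (v * w) - a =
      v * (w * c * star w - b) * star v + (v * b * star v - a) := by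
    simp only [star_mul]; noncomm_ring
  rw [e]
  have h1 : ‖v * (w * c * star w - b) * star v‖ ≤ ε / 2 := by
    calc ‖v * (w * c * star w - b) * star v‖
        ≤ ‖v‖ * ‖w * c * star w - b‖ * ‖star v‖ :=
          (norm_mul_le _ _).trans (by gcongr; exact norm_mul_le _ _)
      _ ≤ ‖v‖ * (ε / (2 * (‖v‖ * ‖v‖ + 1))) * ‖v‖ := by rw [norm_star]; gcongr
      _ = ε / 2 * ((‖v‖ * ‖v‖) / (‖v‖ * ‖v‖ + 1)) := by field_simp
      _ ≤ ε / 2 * 1 := by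
          gcongr
          rw [div_le_one (by positivity)]
          linarith
      _ = ε / 2 := mul_one _
  calc _ ≤ _ := norm_add_le _ _
    _ < ε / 2 + ε / 2 := by linarith
    _ = ε := add_halves ε

theorem CuntzSubeq.mono {B' : StarSubalgebra ℂ A} (h : CuntzSubeq B a b) (hB : B ≤ B') :
    CuntzSubeq B' a b := by
  obtain ⟨v, hv, ht⟩ := h
  exact ⟨v, fun n => hB (hv n), ht⟩

/-- If `0 ≤ a ≤ b` in a C*-algebra `B`, then `a ≾ b` over `B`. -/
theorem cuntzSubeq_of_le (hB : IsClosed (B : Set A)) (ha : a ∈ B) (hb : b ∈ B)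
    (ha0 : IsPosElem a) (hab : IsPosElem (b - a)) : CuntzSubeq B a b := by
  obtain ⟨s, hs, hsa, hsB⟩ := ha0.exists_sqrt
  have hb0 : IsPosElem b := by simpa using ha0.add hab
  let := CStarAlgebra.spectralOrder A
  have := CStarAlgebra.spectralOrderedRing A
  have := hB
  rw [isPosElem_iff_nonneg] at ha0 hab hb0
  rw [sub_nonneg] at hab
  have hsp : ∀ x ∈ spectrum ℝ b, 0 ≤ x := fun x hx => spectrum_nonneg_of_nonneg hb0 hx
  refine cuntzSubeq_of_forall_pos fun ε' hε' => ?_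
  set ε := ε' / 4 with hεdef
  have hε : 0 < ε := by positivity
  have hne : ∀ x ∈ spectrum ℝ b, x + ε ≠ 0 := fun x hx => by have := hsp x hx; positivity
  -- With `K = k(b)` and `W = m(b)`, `K b K` is the square of `b / (b + ε)` and `W² = 1 - K b K`.
  -- Conjugating `b` by `s K` therefore misses `a = s²` by `(W s)* (W s)`, of norm `‖W a W‖ ≤ ‖W b
  -- W‖ ≤ 2ε`.
  set k : ℝ → ℝ := fun t => Real.sqrt t / (t + ε) with hk
  set m : ℝ → ℝ := fun t => Real.sqrt (1 - (t / (t + ε)) ^ 2) with hm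
  have hkc : ContinuousOn k (spectrum ℝ b) :=
    Real.continuous_sqrt.continuousOn.div (by fun_prop) hne
  have hmc : ContinuousOn m (spectrum ℝ b) :=
    Real.continuous_sqrt.comp_continuousOn
      (continuousOn_const.sub ((continuousOn_id.div (by fun_prop) hne).pow 2))
  have hle : ∀ x ∈ spectrum ℝ b, 0 ≤ 1 - (x / (x + ε)) ^ 2 := fun x hx => by
    have := hsp x hx
    have h1 : x / (x + ε) ≤ 1 := by rw [div_le_one (by positivity)]; linarith
    have h0 : 0 ≤ x / (x + ε) := by positivity
    nlinarith
  set K := cfc k b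
  set W := cfc m b
  have hKs : star K = K := (cfc_predicate k b : IsSelfAdjoint _).star_eq
  have hWs : star W = W := (cfc_predicate m b : IsSelfAdjoint _).star_eq
  have hWW : W * W = 1 - K * b * K := by
    have e1 : K * b * K = cfc (fun t => k t * t * k t) b := by
      rw [cfc_mul (fun t => k t * t) k b, cfc_mul k (fun t => t) b, cfc_id' ℝ b]
    rw [e1, ← cfc_one ℝ b, ← cfc_sub (1 : ℝ → ℝ) _ b, ← cfc_mul m m b]
    refine cfc_congr fun x hx => ?_
    have hx0 := hsp x hx
    have hxe := hne x hx
    simp only [hm, hk, Pi.one_apply]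
    rw [Real.mul_self_sqrt (hle x hx)]
    have := Real.mul_self_sqrt hx0
    field_simp
    ring_nf
    rw [show Real.sqrt x ^ 2 = x by rw [sq, this]]
    ring
  have hWbW : ‖W * b * W‖ ≤ 2 * ε := by
    have e1 : W * b * W = cfc (fun t => m t * t * m t) b := by
      rw [cfc_mul (fun t => m t * t) m b, cfc_mul m (fun t => t) b, cfc_id' ℝ b]
    rw [e1]
    refine norm_cfc_le (by positivity) fun x hx => ?_
    have hx0 := hsp x hx
    have hpos : 0 < x + ε := by positivity
    have e2 : m x * x * m x = x * (1 - (x / (x + ε)) ^ 2) := by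
      rw [mul_comm (m x) x, mul_assoc, Real.mul_self_sqrt (hle x hx)]
    rw [e2, Real.norm_of_nonneg (mul_nonneg hx0 (hle x hx))]
    have e3 : x * (1 - (x / (x + ε)) ^ 2) = (x / (x + ε)) * ((2 * x + ε) / (x + ε)) * ε := by
      field_simp; ring
    rw [e3]
    have h1 : x / (x + ε) ≤ 1 := by rw [div_le_one hpos]; linarith
    have h2 : (2 * x + ε) / (x + ε) ≤ 2 := by rw [div_le_iff₀ hpos]; linarith
    have h3 : 0 ≤ (2 * x + ε) / (x + ε) := by positivity
    have h4 : 0 ≤ x / (x + ε) := by positivity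
    have : x / (x + ε) * ((2 * x + ε) / (x + ε)) ≤ 1 * 2 := by gcongr
    nlinarith
  refine ⟨s * K, mul_mem (hsB B hB ha) (cfc_mem _ hb), ?_⟩
  have e : s * K * b * star (s * K) - a = -(star (W * s) * (W * s)) := by
    rw [star_mul, star_mul, hKs, hs, hWs]
    have : s * W * (W * s) = s * (W * W) * s := by noncomm_ring
    rw [this, hWW, ← hsa]
    noncomm_ring
  rw [e, norm_neg, CStarRing.norm_star_mul_self, ← CStarRing.norm_self_mul_star]
  have e2 : W * s * star (W * s) = W * a * W := by
    rw [star_mul, hs, hWs, ← hsa]; noncomm_ring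
  rw [e2]
  have h1 : W * a * W ≤ W * b * W := by
    have := star_left_conjugate_le_conjugate hab W
    rwa [hWs] at this
  have h0 : 0 ≤ W * a * W := by
    have := star_left_conjugate_nonneg ha0 W
    rwa [hWs] at this
  calc ‖W * a * W‖ ≤ ‖W * b * W‖ := CStarAlgebra.norm_le_norm_of_nonneg_of_le h0 h1
    _ ≤ 2 * ε := hWbW
    _ < ε' := by rw [hεdef]; linarith

/-- A closed two-sided ideal containing `b` contains every `a ≾ b`. -/
theorem CuntzSubeq.mem_ideal (h : CuntzSubeq B a b) (I : TwoSidedIdeal A)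
    (hI : IsClosed {x : A | x ∈ I}) (hb : b ∈ I) : a ∈ I := by
  obtain ⟨v, -, ht⟩ := h
  exact hI.mem_of_tendsto ht (.of_forall fun n => I.mul_mem_right _ _ (I.mul_mem_left _ _ hb))

end Cuntz

section Simple

variable {D : Type*} [CStarAlgebra D]

/-- In a simple unital C*-algebra every nonzero positive element `b` is full: some
`∑ cᵢ b cᵢ*` is at least `1`. -/
theorem IsSimpleCStar.exists_sum_conj (hD : IsSimpleCStar D) {b : D} (hb : IsPosElem b)
    (hb0 : b ≠ 0) : ∃ (n : ℕ) (c : Fin n → D), IsPosElem (∑ i, c i * b * star (c i) - 1) := by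
  let S : AddSubgroup D := AddSubgroup.closure {x | ∃ r s, x = r * b * s}
  have hSl : ∀ x y : D, y ∈ S → x * y ∈ S := fun x y hy => by
    induction hy using AddSubgroup.closure_induction with
    | mem z hz =>
      obtain ⟨r, s, rfl⟩ := hz
      exact AddSubgroup.subset_closure ⟨x * r, s, by simp [mul_assoc]⟩
    | zero => simp
    | add y z _ _ hy hz => rw [mul_add]; exact add_mem hy hz
    | neg y _ hy => rw [mul_neg]; exact neg_mem hy
  have hSr : ∀ x y : D, x ∈ S → x * y ∈ S := fun x y hx => by
    induction hx using AddSubgroup.closure_induction with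
    | mem z hz =>
      obtain ⟨r, s, rfl⟩ := hz
      exact AddSubgroup.subset_closure ⟨r, s * y, by simp [mul_assoc]⟩
    | zero => simp
    | add x z _ _ hy hz => rw [add_mul]; exact add_mem hy hz
    | neg y _ hy => rw [neg_mul]; exact neg_mem hy
  let I : TwoSidedIdeal D := TwoSidedIdeal.mk' (S.topologicalClosure : Set D)
    (zero_mem _) (fun hx hy => add_mem hx hy) (fun hx => neg_mem hx)
    (fun {x y} hy => map_mem_closure (continuous_const_mul x) hy fun z hz => hSl x z hz)
    (fun {x y} hx => map_mem_closure (f := (· * y)) (by fun_prop) hx fun z hz => hSr z y hz)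
  have hmem : ∀ x, x ∈ I ↔ x ∈ S.topologicalClosure := fun x => TwoSidedIdeal.mem_mk' _ _ _ _ _ _ _
  have hI : I = ⊤ := by
    refine (hD.2 I ?_).resolve_left fun h => hb0 ?_
    · simp only [hmem]; exact S.isClosed_topologicalClosure
    · have : b ∈ I := (hmem b).2 (S.le_topologicalClosure
        (AddSubgroup.subset_closure ⟨1, 1, by simp⟩))
      rwa [h, TwoSidedIdeal.mem_bot] at this
  have h1 : (1 : D) ∈ closure (S : Set D) := (hmem 1).1 (by rw [hI]; trivial)
  obtain ⟨x, hxS, hx⟩ := Metric.mem_closure_iff.1 h1 (1 / 2) (by norm_num)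
  -- `r b s + s* b r* ≤ r b r* + s* b s`, because `(r - s*) b (r - s*)*` is positive.
  have key : ∀ x ∈ S, ∃ (n : ℕ) (c : Fin n → D),
      IsPosElem (∑ i, c i * b * star (c i) - (x + star x)) := by
    intro x hx
    induction hx using AddSubgroup.closure_induction'' with
    | mem z hz =>
      obtain ⟨r, s, rfl⟩ := hz
      refine ⟨2, ![r, star s], ?_⟩
      have := hb.conj (r - star s)
      simp only [Fin.sum_univ_two, Matrix.cons_val_zero, Matrix.cons_val_one, star_mul,
        hb.star_eq, star_star]
      convert! this using 1
      simp only [star_sub, star_star]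
      noncomm_ring
    | neg_mem z hz =>
      obtain ⟨r, s, rfl⟩ := hz
      refine ⟨2, ![r, star s], ?_⟩
      have := hb.conj (r + star s)
      simp only [Fin.sum_univ_two, Matrix.cons_val_zero, Matrix.cons_val_one, star_mul, star_neg,
        hb.star_eq, star_star]
      convert! this using 1
      simp only [star_add, star_star]
      noncomm_ring
    | zero => exact ⟨0, ![], by simpa using isPosElem_zero⟩
    | add y z _ _ hy hz =>
      obtain ⟨n, c, hc⟩ := hy
      obtain ⟨m, d, hd⟩ := hz
      refine ⟨n + m, Fin.append c d, ?_⟩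
      rw [Fin.sum_univ_add]
      simp only [Fin.append_left, Fin.append_right]
      convert! hc.add hd using 1
      rw [star_add]
      abel
  obtain ⟨n, c, hc⟩ := key x hxS
  refine ⟨n, c, ?_⟩
  -- Distance less than `1 / 2` from `x` to `1` forces `x + x* ≥ 1`.
  have hn : ‖(x - 1) + star (x - 1)‖ ≤ 1 := by
    rw [dist_comm, dist_eq_norm] at hx
    calc _ ≤ ‖x - 1‖ + ‖star (x - 1)‖ := norm_add_le _ _
      _ ≤ 1 := by rw [norm_star]; linarith
  have h2 := isPosElem_add_of_norm_le (a := (x - 1) + star (x - 1)) (by simp [add_comm]) hn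
  convert! hc.add h2 using 1
  simp only [star_sub, star_one, one_smul]
  abel

end Simple

/-! ### Minimal homeomorphisms -/

section Dynamics

variable {X : Type*} [TopologicalSpace X] {h : X ≃ₜ X}

theorem Homeomorph.zpow_add_apply (h : X ≃ₜ X) (m n : ℤ) (x : X) :
    (h ^ (m + n)) x = (h ^ m) ((h ^ n) x) := by
  rw [zpow_add]; rfl

theorem Homeomorph.zpow_neg_apply_zpow (h : X ≃ₜ X) (n : ℤ) (x : X) :
    (h ^ (-n)) ((h ^ n) x) = x := by
  rw [← h.zpow_add_apply, neg_add_cancel]; rfl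

theorem Homeomorph.zpow_apply_zpow_neg (h : X ≃ₜ X) (n : ℤ) (x : X) :
    (h ^ n) ((h ^ (-n)) x) = x := by
  rw [← h.zpow_add_apply, add_neg_cancel]; rfl

/-- Every orbit of a minimal homeomorphism visits a given nonempty open set in every window of
times of a fixed length. -/
theorem IsMinimalHomeo.exists_window [CompactSpace X] (hmin : IsMinimalHomeo h) {V : Set X}
    (hV : IsOpen V) (hne : V.Nonempty) :
    ∃ m : ℕ, ∀ (s : ℤ) (x : X), ∃ t : ℤ, s ≤ t ∧ t < s + m ∧ (h ^ t) x ∈ V := by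
  have hcov : ∀ x : X, ∃ n : ℤ, (h ^ n) x ∈ V := by
    have hcl : IsClosed (⋃ n : ℤ, (h ^ n) ⁻¹' V)ᶜ :=
      (isOpen_iUnion fun n => hV.preimage (h ^ n).continuous).isClosed_compl
    have hinv : h '' (⋃ n : ℤ, (h ^ n) ⁻¹' V)ᶜ = (⋃ n : ℤ, (h ^ n) ⁻¹' V)ᶜ := by
      rw [Set.image_compl_eq h.bijective]
      congr 1
      ext x
      simp only [Set.mem_image, Set.mem_iUnion, Set.mem_preimage]
      constructor
      · rintro ⟨y, ⟨n, hn⟩, rfl⟩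
        refine ⟨n - 1, ?_⟩
        have := h.zpow_add_apply (n - 1) 1 y
        rw [sub_add_cancel, zpow_one] at this
        rwa [← this]
      · rintro ⟨n, hn⟩
        refine ⟨h.symm x, ⟨n + 1, ?_⟩, h.apply_symm_apply x⟩
        rw [h.zpow_add_apply, zpow_one, h.apply_symm_apply]
        exact hn
    rcases hmin _ hcl hinv with h0 | h1
    · intro x
      have : x ∈ ⋃ n : ℤ, (h ^ n) ⁻¹' V := by
        rw [Set.compl_empty_iff.1 h0]; trivial
      simpa using this
    · obtain ⟨v, hv⟩ := hne
      have : v ∈ (⋃ n : ℤ, (h ^ n) ⁻¹' V)ᶜ := by rw [h1]; trivial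
      exact absurd (Set.mem_iUnion.2 ⟨0, by simpa using hv⟩) this
  obtain ⟨T, hT⟩ := isCompact_univ.elim_finite_subcover (fun n : ℤ => (h ^ n) ⁻¹' V)
    (fun n => hV.preimage (h ^ n).continuous) (fun x _ => Set.mem_iUnion.2 (hcov x))
  obtain ⟨M, hM⟩ : ∃ M : ℕ, ∀ t ∈ T, |t| ≤ M :=
    ⟨T.sup Int.natAbs, fun t ht => by
      have := Finset.le_sup (f := Int.natAbs) ht
      rw [Int.abs_eq_natAbs]; exact_mod_cast this⟩
  -- Applying the cover at `h ^ (s + M) x` turns times in `[-M, M]` into times in `[s, s + 2M]`.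
  refine ⟨2 * M + 1, fun s x => ?_⟩
  have := hT (Set.mem_univ ((h ^ (s + M)) x))
  simp only [Set.mem_iUnion, Set.mem_preimage] at this
  obtain ⟨t, ht, htV⟩ := this
  have hb := abs_le.1 (hM t ht)
  refine ⟨t + (s + M), by omega, by push_cast; omega, ?_⟩
  rwa [h.zpow_add_apply]

/-- A periodic orbit is finite, hence closed. Its complement is open, and nonempty as `X` is
infinite, so minimality would force the orbit to enter its own complement. -/
theorem IsMinimalHomeo.zpow_apply_ne [CompactSpace X] [T1Space X] [Infinite X]
    (hmin : IsMinimalHomeo h) {n : ℤ} (hn : n ≠ 0) (x : X) : (h ^ n) x ≠ x := by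
  intro hx
  have hmul : ∀ k : ℤ, (h ^ (n * k)) x = x := by
    intro k
    induction k using Int.induction_on with
    | zero => simp
    | succ k ih => rw [mul_add, mul_one, h.zpow_add_apply, hx, ih]
    | pred k ih =>
      have : n * (-(k : ℤ)) = n * (-(k : ℤ) - 1) + n := by ring
      rw [this, h.zpow_add_apply, hx] at ih
      exact ih
  set O : Set X := (fun k : ℤ => (h ^ k) x) '' (Set.Ico 0 |n|) with hO
  have hOfin : O.Finite := (Set.finite_Ico _ _).image _
  obtain ⟨m, hm⟩ := hmin.exists_window hOfin.isClosed.isOpen_compl hOfin.infinite_compl.nonempty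
  obtain ⟨t, -, -, ht⟩ := hm 0 x
  refine ht ⟨t % n, ⟨Int.emod_nonneg _ hn, Int.emod_lt_abs _ hn⟩, ?_⟩
  conv_rhs => rw [← Int.emod_add_mul_ediv t n]
  rw [h.zpow_add_apply, hmul]

/-- A compact set disjoint from its translates has neighbourhoods disjoint from any given finite
number of their translates. -/
theorem exists_isOpen_disjoint_translates [T2Space X] {Y : Set X} (hY : IsCompact Y)
    (hd : ∀ n : ℤ, n ≠ 0 → ∀ y ∈ Y, (h ^ n) y ∉ Y) (L : ℤ) :
    ∃ W : Set X, IsOpen W ∧ Y ⊆ W ∧ ∀ n : ℤ, n ≠ 0 → |n| ≤ L → ∀ x ∈ W, (h ^ n) x ∉ W := by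
  have key : ∀ n : ℤ, ∃ W : Set X, IsOpen W ∧ Y ⊆ W ∧ (n ≠ 0 → ∀ x ∈ W, (h ^ n) x ∉ W) := by
    intro n
    by_cases hn : n = 0
    · exact ⟨Set.univ, isOpen_univ, Set.subset_univ _, fun h => absurd hn h⟩
    have hc : IsCompact ((h ^ n) ⁻¹' Y) := (h ^ n).isCompact_preimage.2 hY
    obtain ⟨U, V, hU, hV, hYU, hYV, hUV⟩ := SeparatedNhds.of_isCompact_isCompact hY hc
      (Set.disjoint_left.2 fun y hy hy' => hd n hn y hy hy')
    refine ⟨U ∩ (h ^ (-n)) ⁻¹' V, hU.inter (hV.preimage (h ^ (-n)).continuous),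
      fun y hy => ⟨hYU hy, hYV ?_⟩, fun _ x hx hx' => ?_⟩
    · simpa [h.zpow_apply_zpow_neg] using hy
    · have := hx'.2
      rw [Set.mem_preimage, h.zpow_neg_apply_zpow] at this
      exact Set.disjoint_left.1 hUV hx.1 this
  choose W hW hYW hWd using key
  refine ⟨⋂ n ∈ Finset.Icc (-L) L, W n, isOpen_biInter_finset fun n _ => hW n,
    Set.subset_iInter₂ fun n _ => hYW n, fun n hn hnL x hx hx' => ?_⟩
  have hmem : n ∈ Finset.Icc (-L) L := Finset.mem_Icc.2 (abs_le.1 hnL)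
  exact hWd n hn x (Set.mem_iInter₂.1 hx n hmem) (Set.mem_iInter₂.1 hx' n hmem)

/-- Some orbit of a minimal homeomorphism misses a given compact set which is disjoint from all of
its translates. -/
theorem IsMinimalHomeo.exists_orbit_notMem [CompactSpace X] [T2Space X] [Nonempty X]
    (hmin : IsMinimalHomeo h) {Y : Set X} (hY : IsCompact Y)
    (hd : ∀ n : ℤ, n ≠ 0 → ∀ y ∈ Y, (h ^ n) y ∉ Y) : ∃ x : X, ∀ n : ℤ, (h ^ n) x ∉ Y := by
  -- An interior point of `Y` would return to `Y` at a positive time. So the preimages of `Y` are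
  -- closed and nowhere dense, and Baire applies.
  have hint : interior Y = ∅ := by
    by_contra hne
    obtain ⟨y, hy⟩ := Set.nonempty_iff_ne_empty.2 hne
    obtain ⟨m, hm⟩ := hmin.exists_window isOpen_interior ⟨y, hy⟩
    obtain ⟨t, ht, -, htY⟩ := hm 1 y
    exact hd t (by omega) y (interior_subset hy) (interior_subset htY)
  have hdense : Dense (⋂ n : ℤ, ((h ^ n) ⁻¹' Y)ᶜ) := by
    refine dense_iInter_of_isOpen
      (fun n => (hY.isClosed.preimage (h ^ n).continuous).isOpen_compl) fun n => ?_
    rw [← interior_eq_empty_iff_dense_compl, ← (h ^ n).preimage_interior, hint, Set.preimage_empty]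
  obtain ⟨x, hx⟩ := hdense.nonempty
  exact ⟨x, fun n => Set.mem_iInter.1 hx n⟩

end Dynamics

/-! ### Covariant representations over a homeomorphism -/

section Scalars

variable {X : Type*} [TopologicalSpace X] {D : Type*} [CStarAlgebra D]

/-- A real function on `X` as a scalar-valued element of `C(X, D)`. -/
noncomputable def scalarMap (D : Type*) [CStarAlgebra D] : C(X, ℝ) →+* C(X, D) where
  toFun f := ⟨fun x => algebraMap ℝ D (f x), by
    simp only [Algebra.algebraMap_eq_smul_one]; fun_prop⟩
  map_one' := by ext; simp
  map_mul' f g := by ext; simp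
  map_zero' := by ext; simp
  map_add' f g := by ext; simp

/-- An element of `D` as a constant element of `C(X, D)`. -/
noncomputable def constMap (X : Type*) [TopologicalSpace X] [CompactSpace X] :
    D →⋆ₐ[ℂ] C(X, D) where
  toFun d := ContinuousMap.const X d
  map_one' := rfl
  map_mul' _ _ := rfl
  map_zero' := rfl
  map_add' _ _ := rfl
  commutes' _ := rfl
  map_star' _ := rfl

@[simp] theorem scalarMap_apply (f : C(X, ℝ)) (x : X) :
    scalarMap D f x = algebraMap ℝ D (f x) := rfl

theorem scalarMap_commute (f : C(X, ℝ)) (g : C(X, D)) :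
    scalarMap D f * g = g * scalarMap D f := by
  ext x; exact Algebra.commutes _ _

theorem scalarMap_smul (r : ℝ) (f : C(X, ℝ)) : scalarMap D (r • f) = r • scalarMap D f := by
  ext x; simp [Algebra.algebraMap_eq_smul_one, mul_smul]

@[simp] theorem constMap_apply [CompactSpace X] (d : D) (x : X) : constMap X d x = d := rfl

@[simp] theorem star_scalarMap (f : C(X, ℝ)) : star (scalarMap D f) = scalarMap D f := by
  ext x; simp [← algebraMap_star_comm]

theorem exists_sqrt_fn {f : C(X, ℝ)} (hf : 0 ≤ f) :
    ∃ s : C(X, ℝ), 0 ≤ s ∧ s * s = f ∧ ∀ x, f x = 0 → s x = 0 :=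
  ⟨⟨fun x => Real.sqrt (f x), by fun_prop⟩, fun x => Real.sqrt_nonneg _,
    by ext x; exact Real.mul_self_sqrt (hf x), fun x hx => by simp [hx]⟩

theorem isPosElem_scalarMap [CompactSpace X] {f : C(X, ℝ)} (hf : 0 ≤ f) : IsPosElem (scalarMap D f) := by
  obtain ⟨s, -, rfl, -⟩ := exists_sqrt_fn hf
  exact ⟨scalarMap D s, by simp⟩

end Scalars

section Fiber

variable {X : Type*} [TopologicalSpace X] {D : Type*} [CStarAlgebra D]
  {h : X ≃ₜ X} {α : C(X, D) ≃⋆ₐ[ℂ] C(X, D)}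

/-- Unital automorphisms of `D` fix the multiples of `1`, so the fibre automorphisms disappear. This
is why all cut-off functions are taken scalar. -/
theorem LiesOver.zpow_scalarMap (hα : LiesOver h α) (n : ℤ) (f : C(X, ℝ)) :
    (α ^ n) (scalarMap D f) = scalarMap D (f.comp ((h ^ (-n) : X ≃ₜ X) : C(X, X))) := by
  obtain ⟨β, hβ⟩ := hα
  ext x
  rw [hβ n x]
  simp only [scalarMap_apply, ContinuousMap.comp_apply, ContinuousMap.coe_coe,
    Algebra.algebraMap_eq_smul_one]
  rw [← Complex.coe_smul, map_smul, map_one, Complex.coe_smul]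

theorem LiesOver.zpow_apply_eq_zero (hα : LiesOver h α) {n : ℤ} {f : C(X, D)} {x : X}
    (hx : f ((h ^ (-n)) x) = 0) : (α ^ n) f x = 0 := by
  obtain ⟨β, hβ⟩ := hα
  rw [hβ n x, hx, map_zero]

end Fiber

/-- A covariant representation of the automorphism `α` of `C` in the C*-algebra `A`. -/
structure CovariantRep {C : Type*} [CStarAlgebra C] (α : C ≃⋆ₐ[ℂ] C)
    (A : Type*) [CStarAlgebra A] where
  /-- the representation of the coefficient algebra -/
  ι : C →⋆ₐ[ℂ] A
  /-- the implementing unitary -/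
  U : unitary A
  cov : ∀ f, (U : A) * ι f = ι (α f) * U

namespace CovariantRep

section General

variable {C : Type*} [CStarAlgebra C] {α : C ≃⋆ₐ[ℂ] C} {A : Type*} [CStarAlgebra A]
  (R : CovariantRep α A)

/-- Integer powers of the implementing unitary. -/
noncomputable def pow (n : ℤ) : A := ((R.U ^ n : unitary A) : A)

@[simp] theorem pow_zero : R.pow 0 = 1 := by simp [pow]

theorem pow_one : R.pow 1 = R.U := by simp [pow]

theorem pow_add (m n : ℤ) : R.pow (m + n) = R.pow m * R.pow n := by simp [pow, zpow_add]

@[simp] theorem star_pow (n : ℤ) : star (R.pow n) = R.pow (-n) := by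
  rw [pow, pow, ← Unitary.coe_star, Unitary.star_eq_inv, zpow_neg]

theorem pow_neg_mul_pow (n : ℤ) : R.pow (-n) * R.pow n = 1 := by simp [← pow_add]

theorem pow_mul_pow_neg (n : ℤ) : R.pow n * R.pow (-n) = 1 := by simp [← pow_add]

theorem pow_mul_ι (n : ℤ) (f : C) : R.pow n * R.ι f = R.ι ((α ^ n) f) * R.pow n := by
  have hneg : ∀ f, R.pow (-1) * R.ι f = R.ι ((α ^ (-1 : ℤ)) f) * R.pow (-1) := by
    intro f
    have h1 := R.cov ((α ^ (-1 : ℤ)) f)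
    have h2 : α ((α ^ (-1 : ℤ)) f) = f := by
      rw [zpow_neg_one]; exact α.apply_symm_apply f
    rw [h2, ← R.pow_one] at h1
    calc R.pow (-1) * R.ι f = R.pow (-1) * (R.ι f * R.pow 1) * R.pow (-1) := by
          rw [mul_assoc, mul_assoc, R.pow_mul_pow_neg, mul_one]
      _ = R.pow (-1) * R.pow 1 * R.ι ((α ^ (-1 : ℤ)) f) * R.pow (-1) := by
          rw [← h1]; noncomm_ring
      _ = _ := by rw [R.pow_neg_mul_pow, one_mul]
  induction n using Int.induction_on generalizing f with
  | zero => simp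
  | succ k ih =>
    rw [R.pow_add, mul_assoc, R.pow_one, R.cov, ← mul_assoc, ih, mul_assoc, zpow_add, zpow_one]
    rfl
  | pred k ih =>
    rw [sub_eq_add_neg, R.pow_add, mul_assoc, hneg, ← mul_assoc, ih, mul_assoc, zpow_add]
    rfl

end General

section Over

variable {X : Type*} [TopologicalSpace X] [CompactSpace X] {D : Type*} [CStarAlgebra D]
  {h : X ≃ₜ X} {α : C(X, D) ≃⋆ₐ[ℂ] C(X, D)} {A : Type*} [CStarAlgebra A]
  (R : CovariantRep α A)

/-- The image of a scalar function. -/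
noncomputable def scalar (f : C(X, ℝ)) : A := R.ι (scalarMap D f)

theorem scalar_mul (f g : C(X, ℝ)) : R.scalar (f * g) = R.scalar f * R.scalar g := by
  simp [scalar]

@[simp] theorem scalar_one : R.scalar 1 = 1 := by simp [scalar]

theorem scalar_commute (f : C(X, ℝ)) (g : C(X, D)) : R.scalar f * R.ι g = R.ι g * R.scalar f := by
  rw [scalar, ← map_mul, scalarMap_commute, map_mul]

@[simp] theorem star_scalar (f : C(X, ℝ)) : star (R.scalar f) = R.scalar f := by
  rw [scalar, ← map_star, star_scalarMap]

theorem pow_mul_scalar (hα : LiesOver h α) (n : ℤ) (f : C(X, ℝ)) :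
    R.pow n * R.scalar f = R.scalar (f.comp ((h ^ (-n) : X ≃ₜ X) : C(X, X))) * R.pow n := by
  rw [scalar, R.pow_mul_ι, hα.zpow_scalarMap, scalar]

/-- `B` contains the generators of the `Y`-orbit breaking subalgebra. -/
structure Breaks (Y : Set X) (B : StarSubalgebra ℂ A) : Prop where
  isClosed : IsClosed (B : Set A)
  ι_mem : ∀ f, R.ι f ∈ B
  mul_U_mem : ∀ f : C(X, D), (∀ y ∈ Y, f y = 0) → R.ι f * R.U ∈ B

variable {R} {Y : Set X} {B : StarSubalgebra ℂ A}

/-- With `s² = f`, one has `f uⁿ⁺¹ = (s u) ((s ∘ h) uⁿ)`. The first factor needs `s = 0` on `Y`, and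
the second inherits the remaining vanishing conditions shifted by one. -/
theorem Breaks.scalar_mul_pow_natCast_mem (hB : R.Breaks Y B) (hα : LiesOver h α) (n : ℕ)
    (f : C(X, ℝ)) (hf : 0 ≤ f)
    (hv : ∀ j : ℤ, 0 ≤ j → j < n → ∀ y ∈ Y, f ((h ^ j) y) = 0) :
    R.scalar f * R.pow n ∈ B := by
  induction n generalizing f with
  | zero => simpa [scalar] using hB.ι_mem (scalarMap D f)
  | succ n ih =>
    obtain ⟨s, hs0, hsf, hs⟩ := exists_sqrt_fn hf
    have hcov := R.pow_mul_scalar hα 1 (s.comp (h : C(X, X)))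
    have hs' : (s.comp (h : C(X, X))).comp ((h ^ (-1 : ℤ) : X ≃ₜ X) : C(X, X)) = s := by
      ext x
      exact congrArg s (h.apply_symm_apply x)
    rw [hs'] at hcov
    have e : R.scalar f * R.pow (n + 1 : ℕ) =
        (R.scalar s * R.U) * (R.scalar (s.comp (h : C(X, X))) * R.pow n) := by
      rw [← hsf, R.scalar_mul, ← R.pow_one]
      rw [show R.scalar s * R.pow 1 * (R.scalar (s.comp (h : C(X, X))) * R.pow n) =
        R.scalar s * (R.pow 1 * R.scalar (s.comp (h : C(X, X)))) * R.pow n by noncomm_ring, hcov]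
      push_cast
      rw [add_comm (n : ℤ) 1, R.pow_add]
      noncomm_ring
    rw [e]
    refine mul_mem (hB.mul_U_mem _ fun y hy => ?_) (ih _ (fun x => hs0 (h x)) fun j hj hjn y hy => ?_)
    · have := hs _ (hv 0 le_rfl (by positivity) y hy)
      simp only [zpow_zero] at this
      simp only [scalarMap_apply]
      rw [show s y = 0 from this, map_zero]
    · refine hs _ ?_
      have := hv (1 + j) (by omega) (by push_cast; omega) y hy
      rwa [h.zpow_add_apply, zpow_one] at this

theorem Breaks.scalar_mul_pow_mem (hB : R.Breaks Y B) (hα : LiesOver h α) (n : ℤ)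
    (f : C(X, ℝ)) (hf : 0 ≤ f)
    (hv : ∀ j : ℤ, (0 ≤ j ∧ j < n) ∨ (n ≤ j ∧ j < 0) → ∀ y ∈ Y, f ((h ^ j) y) = 0) :
    R.scalar f * R.pow n ∈ B := by
  obtain ⟨k, rfl | rfl⟩ := n.eq_nat_or_neg
  · exact hB.scalar_mul_pow_natCast_mem hα k f hf fun j h0 hk => hv j (Or.inl ⟨h0, hk⟩)
  -- Negative powers are adjoints: `f u⁻ᵏ` is the adjoint of `(f ∘ h⁻ᵏ) uᵏ`.
  · have := star_mem (hB.scalar_mul_pow_natCast_mem hα k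
      (f.comp ((h ^ (-(k : ℤ)) : X ≃ₜ X) : C(X, X))) (fun x => hf ((h ^ (-(k : ℤ))) x)) fun j h0 hk y hy => ?_)
    · rwa [star_mul, R.star_scalar, R.star_pow, R.pow_mul_scalar hα, ContinuousMap.comp_assoc,
        show ((h ^ (-(k : ℤ)) : X ≃ₜ X) : C(X, X)).comp
          ((h ^ (- -(k : ℤ)) : X ≃ₜ X) : C(X, X)) = ContinuousMap.id X from
          ContinuousMap.ext fun x => h.zpow_apply_zpow_neg _ x, ContinuousMap.comp_id] at this
    · have := hv (-k + j) (Or.inr ⟨by omega, by omega⟩) y hy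
      rwa [h.zpow_add_apply] at this

/-- Conjugation by a sum of elements `W i U ^ k i` whose supports are moved to disjoint sets. -/
theorem sum_conj (R : CovariantRep α A) (hα : LiesOver h α) {κ : Type*} [Fintype κ] (k : κ → ℤ)
    (W : κ → C(X, D)) (Z : C(X, D))
    (hd : ∀ i j, i ≠ j → ∀ x, W i ((h ^ k i) x) = 0 ∨ W j ((h ^ k j) x) = 0) :
    (∑ i, R.ι (W i) * R.pow (k i)) * R.ι Z * star (∑ i, R.ι (W i) * R.pow (k i)) =
      R.ι (∑ i, W i * (α ^ k i) Z * star (W i)) := by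
  classical
  rw [star_sum, Finset.sum_mul, Finset.sum_mul_sum, map_sum]
  refine Finset.sum_congr rfl fun i _ => ?_
  have hij : ∀ j, R.ι (W i) * R.pow (k i) * R.ι Z * star (R.ι (W j) * R.pow (k j)) =
      R.ι (W i * (α ^ k i) Z * (α ^ (k i - k j)) (star (W j))) * R.pow (k i - k j) := by
    intro j
    rw [star_mul, R.star_pow, ← map_star, map_mul, map_mul]
    calc _ = R.ι (W i) * (R.pow (k i) * R.ι Z) * (R.pow (-k j) * R.ι (star (W j))) := by
          noncomm_ring
      _ = R.ι (W i) * R.ι ((α ^ k i) Z) * (R.pow (k i) * R.pow (-k j) * R.ι (star (W j))) := by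
          rw [R.pow_mul_ι]; noncomm_ring
      _ = _ := by rw [← R.pow_add, ← sub_eq_add_neg, R.pow_mul_ι]; noncomm_ring
  rw [Finset.sum_eq_single i]
  · rw [hij, sub_self]; simp
  · intro j _ hji
    rw [hij]
    convert zero_mul (R.pow (k i - k j))
    convert map_zero R.ι
    ext x
    simp only [ContinuousMap.mul_apply, ContinuousMap.zero_apply]
    -- The off-diagonal coefficient at `x` contains `W i` at `x` and `W j` at `h ^ (k j - k i) x`.
    -- Disjointness at `h ^ (-k i) x` kills one of them.
    rcases hd i j hji.symm ((h ^ (-k i)) x) with h0 | h0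
    · rw [h.zpow_apply_zpow_neg] at h0
      rw [h0, zero_mul, zero_mul]
    · rw [hα.zpow_apply_eq_zero (n := k i - k j), mul_zero]
      rw [← h.zpow_add_apply] at h0
      rw [ContinuousMap.star_apply, show -(k i - k j) = k j + -k i by ring, h0, star_zero]
  · simp

end Over

end CovariantRep

/-! ### Comparison near a point whose orbit avoids `Y`. -/

section PseudoperiodicSum

variable {D : Type*} [CStarAlgebra D]

/-- If `b ≾ zᵢ` for finitely many elements `zᵢ`, as many as are needed to generate the unit from
`b`, then some `∑ eᵢ zᵢ eᵢ*` is at least `3 / 4`. -/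
theorem exists_sum_conj_of_cuntzSubeq {b : D} {n : ℕ} {c : Fin n → D}
    (hb : IsPosElem b) (hc : IsPosElem (∑ i, c i * b * star (c i) - 1)) (z : Fin n → D)
    (hz0 : ∀ i, IsPosElem (z i)) (hz : ∀ i, CuntzSubeq ⊤ b (z i)) :
    ∃ e : Fin n → D, IsPosElem (∑ i, e i * z i * star (e i) - (3 / 4 : ℝ) • (1 : D)) := by
  set M : ℝ := ∑ i, ‖c i‖ * ‖c i‖ with hM
  have hM0 : 0 ≤ M := Finset.sum_nonneg fun i _ => by positivity
  -- Weighted by `M = ∑ ‖c i‖²`, this tolerance yields a total error of at most `1 / 4`.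
  have hε : 0 < 1 / (4 * (M + 1)) := by positivity
  choose d _ hd using fun i => (hz i).exists_norm_lt hε
  refine ⟨fun i => c i * d i, ?_⟩
  have hnorm : ‖∑ i, c i * (d i * z i * star (d i) - b) * star (c i)‖ ≤ 1 / 4 := by
    calc _ ≤ ∑ i, ‖c i * (d i * z i * star (d i) - b) * star (c i)‖ := norm_sum_le _ _
      _ ≤ ∑ i, ‖c i‖ * ‖c i‖ * (1 / (4 * (M + 1))) := by
          refine Finset.sum_le_sum fun i _ => ?_
          calc _ ≤ ‖c i‖ * ‖d i * z i * star (d i) - b‖ * ‖star (c i)‖ :=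
                (norm_mul_le _ _).trans (by gcongr; exact norm_mul_le _ _)
            _ ≤ ‖c i‖ * (1 / (4 * (M + 1))) * ‖c i‖ := by
                rw [norm_star]; gcongr; exact (hd i).le
            _ = _ := by ring
      _ = M * (1 / (4 * (M + 1))) := by rw [← Finset.sum_mul]
      _ = 1 / 4 * (M / (M + 1)) := by field_simp
      _ ≤ 1 / 4 * 1 := by gcongr; rw [div_le_one (by positivity)]; linarith
      _ = 1 / 4 := by norm_num
  have hsa : star (∑ i, c i * (d i * z i * star (d i) - b) * star (c i)) =
      ∑ i, c i * (d i * z i * star (d i) - b) * star (c i) := by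
    rw [star_sum]
    refine Finset.sum_congr rfl fun i _ => ?_
    simp only [star_mul, star_sub, star_star, (hz0 i).star_eq, hb.star_eq]
    noncomm_ring
  convert! (isPosElem_add_of_norm_le hsa hnorm).add hc using 1
  have h1 : ∑ i, c i * (d i * z i * star (d i) - b) * star (c i) =
      ∑ i, c i * d i * z i * star (c i * d i) - ∑ i, c i * b * star (c i) := by
    rw [← Finset.sum_sub_distrib]
    refine Finset.sum_congr rfl fun i _ => ?_
    rw [star_mul]; noncomm_ring
  rw [h1]
  have h2 : (1 : D) = (1 / 4 : ℝ) • (1 : D) + (3 / 4 : ℝ) • (1 : D) := by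
    rw [← add_smul]; norm_num
  nth_rewrite 3 [h2]
  abel

end PseudoperiodicSum

section Localize

variable {X : Type*} [TopologicalSpace X] [CompactSpace X] {D : Type*} [CStarAlgebra D]

/-- A self-adjoint `S ∈ C(X, D)` with `S x ≥ 3 / 4` dominates `G / 2` after multiplication by any
scalar function `G` supported near `x`. -/
theorem isPosElem_scalarMap_mul_sub {S : C(X, D)} (hS : star S = S) {x : X}
    (hx : IsPosElem (S x - (3 / 4 : ℝ) • (1 : D))) {G : C(X, ℝ)} (hG : 0 ≤ G)
    (hGS : ∀ y, 1 / 4 < ‖S y - S x‖ → G y = 0) :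
    IsPosElem (scalarMap D ((2 : ℝ) • G) * S - scalarMap D G) := by
  obtain ⟨g, -, rfl, hg⟩ := exists_sqrt_fn hG
  set Q := S x
  have hQ : star Q = Q := by rw [← ContinuousMap.star_apply, hS]
  -- `ρ` is `1` on the support of `g` and truncates `S - Q` to norm at most `1 / 4` everywhere.
  -- Positivity thus follows from a global norm estimate in `C(X, D)`.
  let ρ : C(X, ℝ) := ⟨fun y => (1 / 4) / max ‖S y - Q‖ (1 / 4),
    Continuous.div (by fun_prop) (by fun_prop) fun y => by positivity⟩
  have hρ : ∀ y, g y * ρ y = g y := fun y => by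
    by_cases hy : 1 / 4 < ‖S y - Q‖
    · rw [hg y (hGS y hy), zero_mul]
    · have : ρ y = 1 := by
        change (1 / 4) / max ‖S y - Q‖ (1 / 4) = 1
        rw [max_eq_right (not_lt.1 hy)]; norm_num
      rw [this, mul_one]
  have hT : ‖scalarMap D ρ * (S - constMap X Q)‖ ≤ 1 / 4 := by
    rw [ContinuousMap.norm_le _ (by norm_num)]
    intro y
    have : ‖(scalarMap D ρ * (S - constMap X Q)) y‖ = ‖ρ y • (S y - Q)‖ := by
      simp [Algebra.algebraMap_eq_smul_one]
    rw [this, norm_smul]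
    have h0 : 0 ≤ ρ y := by
      change 0 ≤ (1 / 4) / max ‖S y - Q‖ (1 / 4)
      positivity
    rw [Real.norm_of_nonneg h0]
    change (1 / 4) / max ‖S y - Q‖ (1 / 4) * ‖S y - Q‖ ≤ 1 / 4
    rw [div_mul_eq_mul_div, div_le_iff₀ (by positivity)]
    gcongr
    exact le_max_left _ _
  have hTs : star (scalarMap D ρ * (S - constMap X Q)) = scalarMap D ρ * (S - constMap X Q) := by
    rw [star_mul, star_scalarMap, star_sub, hS, ← map_star, hQ, scalarMap_commute]
  have h1 := (isPosElem_add_of_norm_le hTs hT).conj (scalarMap D g)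
  have h2 := (hx.map (constMap X)).conj (scalarMap D g)
  -- On the support of `g`, `S ≥ 3/4 - 1/4 = 1/2`, whence the factor `2`.
  have h3 := (h1.add h2).smul (r := 2) (by norm_num)
  convert! h3 using 1
  have hPr : scalarMap D g * scalarMap D ρ = scalarMap D g := by
    rw [← map_mul]; congr 1; ext y; exact hρ y
  have hPS : scalarMap D g * S * scalarMap D g = scalarMap D g * scalarMap D g * S := by
    rw [mul_assoc, ← scalarMap_commute, mul_assoc]
  have e1 : scalarMap D g * (scalarMap D ρ * (S - constMap X Q) + (1 / 4 : ℝ) • 1) * scalarMap D g =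
      scalarMap D g * S * scalarMap D g - scalarMap D g * constMap X Q * scalarMap D g +
        (1 / 4 : ℝ) • (scalarMap D g * scalarMap D g) := by
    rw [mul_add, ← mul_assoc, hPr, add_mul, mul_smul_comm, mul_one, smul_mul_assoc]
    noncomm_ring
  have e2 : constMap X (Q - (3 / 4 : ℝ) • (1 : D)) = constMap X Q - (3 / 4 : ℝ) • 1 := rfl
  rw [star_scalarMap, e1, e2, scalarMap_smul, map_mul, hPS, smul_mul_assoc, mul_sub, sub_mul,
    mul_smul_comm, mul_one, smul_mul_assoc]
  module

end Localize

section LocalComparison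

theorem IsPseudoperiodicallyGenerated.liesOver {X : Type*} [TopologicalSpace X] {D : Type*}
    [CStarAlgebra D] {h : X ≃ₜ X} {α : C(X, D) ≃⋆ₐ[ℂ] C(X, D)}
    (hper : IsPseudoperiodicallyGenerated h α) : LiesOver h α :=
  ⟨hper.choose, hper.choose_spec.1⟩

variable {X : Type*} [TopologicalSpace X] [CompactSpace X] [T2Space X] [Infinite X]
  {D : Type*} [CStarAlgebra D] {h : X ≃ₜ X} {α : C(X, D) ≃⋆ₐ[ℂ] C(X, D)}
  {A : Type*} [CStarAlgebra A] {R : CovariantRep α A} {Y : Set X} {B : StarSubalgebra ℂ A}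

/-- Scalar functions supported near a point whose orbit misses `Y` are dominated by any given
nonzero element `φ ⊗ a`. -/
theorem CovariantRep.Breaks.exists_nhd_scalar_cuntzSubeq (hB : R.Breaks Y B)
    (hD : IsSimpleCStar D) (hmin : IsMinimalHomeo h) (hper : IsPseudoperiodicallyGenerated h α)
    (hY : IsClosed Y) {x₀ : X} (hx₀ : ∀ n : ℤ, (h ^ n) x₀ ∉ Y)
    {φ : C(X, ℝ)} (hφ : 0 ≤ φ) (hφ0 : φ ≠ 0) {a : D} (ha : IsPosElem a) (ha0 : a ≠ 0) :
    ∃ V : Set X, IsOpen V ∧ x₀ ∈ V ∧ ∀ G : C(X, ℝ), 0 ≤ G → (∀ x ∉ V, G x = 0) →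
      CuntzSubeq B (R.scalar G) (R.ι (scalarMap D φ * constMap X a)) := by
  have hα := hper.liesOver
  obtain ⟨β, hβ, hps⟩ := hper
  obtain ⟨b, hb, hb0, hbβ⟩ := hps a ha ha0
  -- The number `n` of conjugates is fixed by `b` before any times are chosen. This is possible
  -- because `b` lies below `β k x a` for all `k` and `x` at once.
  obtain ⟨n, c, hc⟩ := hD.exists_sum_conj hb hb0
  obtain ⟨z, hz⟩ : ∃ z, φ z ≠ 0 := by
    by_contra! hne
    exact hφ0 (ContinuousMap.ext hne)
  have hzpos : 0 < φ z := lt_of_le_of_ne (hφ z) (Ne.symm hz)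
  set η := φ z / 2 with hη
  have hηpos : 0 < η := by positivity
  set V₀ : Set X := {x | η < φ x} with hV₀
  have hV₀o : IsOpen V₀ := isOpen_lt continuous_const φ.continuous
  obtain ⟨m, hm⟩ := hmin.exists_window hV₀o ⟨z, show φ z / 2 < φ z by linarith⟩
  -- One visit in each of `n` consecutive windows beginning at time `1`, so the times are positive
  -- and strictly increasing.
  choose t ht1 ht2 htV using fun i : Fin n => hm (1 + i * m) x₀
  have htlt : ∀ i j : Fin n, i < j → t i < t j := fun i j hij => by
    have h1 := ht2 i
    have h2 := ht1 j
    have h3 : ((i : ℕ) : ℤ) + 1 ≤ (j : ℕ) := by exact_mod_cast hij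
    nlinarith
  have ht0 : ∀ i, 1 ≤ t i := fun i => le_trans (by nlinarith [ht1 i]) (ht1 i)
  have hL : ∀ i, t i ≤ 1 + n * m := fun i => by
    have h1 := ht2 i
    have h3 : ((i : ℕ) : ℤ) + 1 ≤ n := by exact_mod_cast i.2
    nlinarith
  set L : ℤ := 1 + n * m
  obtain ⟨e, he⟩ := exists_sum_conj_of_cuntzSubeq hb hc (fun i => β (-t i) x₀ a)
    (fun i => ha.map (β (-t i) x₀ : D →⋆ₐ[ℂ] D)) (fun i => hbβ _ (Or.inl ⟨_, _, rfl⟩))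
  set S : C(X, D) := ∑ i, constMap X (e i) * (α ^ (-t i)) (constMap X a) * constMap X (star (e i))
    with hS
  have hSx : S x₀ = ∑ i, e i * β (-t i) x₀ a * star (e i) := by
    simp only [hS, ContinuousMap.sum_apply, ContinuousMap.mul_apply, constMap_apply]
    refine Finset.sum_congr rfl fun i _ => ?_
    rw [hβ, constMap_apply]
  have hSs : star S = S := by
    rw [hS, star_sum]
    refine Finset.sum_congr rfl fun i _ => ?_
    rw [star_mul, star_mul, ← map_star, ← map_star, ← map_star, ← map_star, star_star, ha.star_eq,
      mul_assoc]
  rw [← hSx] at he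
  obtain ⟨W, hW, hxW, hWd⟩ := exists_isOpen_disjoint_translates (h := h)
    (isCompact_singleton (x := x₀))
    (fun k hk y hy => by
      rw [Set.mem_singleton_iff] at hy
      rw [hy]
      exact hmin.zpow_apply_ne hk x₀) L
  -- The four conditions on a point `x` serve in turn to bound `S` below, to keep the translates of
  -- the support disjoint, to ensure `φ (h ^ t i x) > η`, and to keep the path of the support off
  -- `Y`, so that the conjugating element lies in `B`.
  refine ⟨{x | ‖S x - S x₀‖ < 1 / 4} ∩ W ∩ (⋂ i, (h ^ t i) ⁻¹' V₀) ∩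
    ⋂ j ∈ Finset.Icc 1 L, ((h ^ j) ⁻¹' Y)ᶜ, ?_, ?_, fun G hG hGV => ?_⟩
  · exact (((isOpen_lt (by fun_prop) continuous_const).inter hW).inter
      (isOpen_iInter_of_finite fun i => hV₀o.preimage (h ^ t i).continuous)).inter
      (isOpen_biInter_finset fun j _ => (hY.preimage (h ^ j).continuous).isOpen_compl)
  · exact ⟨⟨⟨by simp, hxW rfl⟩, Set.mem_iInter.2 htV⟩, Set.mem_iInter₂.2 fun j _ => hx₀ j⟩
  have hGV' : ∀ x, G x ≠ 0 → ‖S x - S x₀‖ < 1 / 4 ∧ x ∈ W ∧ (∀ i, (h ^ t i) x ∈ V₀) ∧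
      ∀ j, 1 ≤ j → j ≤ L → (h ^ j) x ∉ Y := fun x hx => by
    have := not_imp_comm.1 (hGV x) hx
    exact ⟨this.1.1.1, this.1.1.2, Set.mem_iInter.1 this.1.2, fun j h1 h2 =>
      Set.mem_iInter₂.1 this.2 j (Finset.mem_Icc.2 ⟨h1, h2⟩)⟩
  have hle := isPosElem_scalarMap_mul_sub hSs he hG fun y hy => by
    by_contra hne
    exact lt_asymm hy (hGV' y hne).1
  have h1 : CuntzSubeq B (R.scalar G) (R.ι (scalarMap D ((2 : ℝ) • G) * S)) := by
    refine cuntzSubeq_of_le hB.isClosed (hB.ι_mem _) (hB.ι_mem _) ((isPosElem_scalarMap hG).map R.ι)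
      ?_
    rw [CovariantRep.scalar, ← map_sub]
    exact hle.map R.ι
  refine h1.trans ?_
  -- Chosen so that `q i` times `φ ∘ h ^ t i` is `2 G`. The maximum with `η` keeps the quotient
  -- continuous and is inactive where `G ≠ 0`.
  let q : Fin n → C(X, ℝ) := fun i => ⟨fun x => 2 * G x / max (φ ((h ^ t i) x)) η,
    Continuous.div (by fun_prop) (by fun_prop) fun y => by positivity⟩
  have hq0 : ∀ i, 0 ≤ q i := fun i x => by
    change 0 ≤ 2 * G x / max (φ ((h ^ t i) x)) η
    have := hG x
    change 0 ≤ G x at this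
    positivity
  choose r hr0 hrq hrz using fun i => exists_sqrt_fn (hq0 i)
  have hrG : ∀ i x, r i x ≠ 0 → G x ≠ 0 := fun i x hx hGx => hx (hrz i x (by simp [q, hGx]))
  have hrφ : ∀ i, r i * r i * φ.comp ((h ^ t i : X ≃ₜ X) : C(X, X)) = (2 : ℝ) • G := fun i => by
    rw [hrq]
    ext x
    change 2 * G x / max (φ ((h ^ t i) x)) η * φ ((h ^ t i) x) = 2 * G x
    by_cases hx : G x = 0
    · simp [hx]
    · have hlt : η < φ ((h ^ t i) x) := (hGV' x hx).2.2.1 i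
      have : φ ((h ^ t i) x) ≠ 0 := by linarith
      rw [max_eq_left hlt.le]
      field_simp
  have hsum : R.ι (scalarMap D ((2 : ℝ) • G) * S) =
      (∑ i, R.ι (constMap X (e i) * scalarMap D (r i)) * R.pow (-t i)) *
        R.ι (scalarMap D φ * constMap X a) *
        star (∑ i, R.ι (constMap X (e i) * scalarMap D (r i)) * R.pow (-t i)) := by
    rw [R.sum_conj hα]
    · congr 1
      rw [hS, Finset.mul_sum]
      refine Finset.sum_congr rfl fun i _ => ?_
      rw [map_mul, hα.zpow_scalarMap, neg_neg, star_mul, star_scalarMap, ← map_star, ← hrφ i,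
        map_mul, map_mul]
      ext x
      simp only [ContinuousMap.mul_apply, scalarMap_apply, constMap_apply, Algebra.algebraMap_eq_smul_one,
        smul_mul_assoc, mul_smul_comm, one_mul, mul_one, smul_smul]
      congr 1
      ring
    · intro i j hij x
      by_contra! hne
      have hx : ∀ i, (constMap X (e i) * scalarMap D (r i)) ((h ^ (-t i)) x) ≠ 0 →
          G ((h ^ (-t i)) x) ≠ 0 := fun i hi => hrG i _ fun h0 => hi (by
        rw [ContinuousMap.mul_apply, scalarMap_apply, h0, map_zero, mul_zero])
      have hi := (hGV' _ (hx i hne.1)).2.1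
      have hj := (hGV' _ (hx j hne.2)).2.1
      refine hWd (t i - t j) ?_ ?_ _ hi ?_
      · rcases lt_or_gt_of_ne hij with hlt | hlt
        · have := htlt i j hlt; omega
        · have := htlt j i hlt; omega
      · have := ht0 i; have := ht0 j; have := hL i; have := hL j
        rw [abs_le]; constructor <;> omega
      · rwa [← h.zpow_add_apply, show t i - t j + -t i = -t j by ring]
  rw [hsum]
  refine cuntzSubeq_conj (sum_mem fun i _ => ?_) _
  rw [map_mul, mul_assoc]
  refine mul_mem (hB.ι_mem _) (hB.scalar_mul_pow_mem hα _ _ (hr0 i) fun j hj y hy => ?_)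
  by_contra hne
  have hj' : -t i ≤ j ∧ j < 0 := by
    have := ht0 i
    omega
  refine (hGV' _ (hrG i _ hne)).2.2.2 (-j) (by omega) (by have := hL i; omega) ?_
  rwa [h.zpow_neg_apply_zpow]

end LocalComparison

/-! ### Cutting down to elementary tensors, and injectivity on the coefficient algebra. -/

section Bump

variable {X : Type*} [TopologicalSpace X] [CompactSpace X]

theorem exists_bump [T2Space X] {V : Set X} (hV : IsOpen V) {x : X} (hx : x ∈ V) :
    ∃ G : C(X, ℝ), 0 ≤ G ∧ (∀ y, G y ≤ 1) ∧ (∀ y ∉ V, G y = 0) ∧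
      ∃ W : Set X, IsOpen W ∧ x ∈ W ∧ ∀ y ∈ W, G y = 1 := by
  obtain ⟨K, hK, hKc, hKV⟩ := exists_mem_nhds_isClosed_subset (hV.mem_nhds hx)
  obtain ⟨G, hG0, hG1, hG⟩ := exists_continuous_zero_one_of_isClosed hV.isClosed_compl hKc
    (Set.disjoint_left.2 fun y hy hy' => hy (hKV hy'))
  exact ⟨G, fun y => (hG y).1, fun y => (hG y).2, fun y hy => hG0 hy, interior K,
    isOpen_interior, mem_interior_iff_mem_nhds.2 hK, fun y hy => hG1 (interior_subset hy)⟩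

theorem norm_scalarMap_mul_le {D : Type*} [CStarAlgebra D] {f : C(X, ℝ)} (hf0 : 0 ≤ f)
    (hf1 : ∀ x, f x ≤ 1) {p : C(X, D)} {δ : ℝ} (hδ : 0 ≤ δ) (hp : ∀ x, f x ≠ 0 → ‖p x‖ ≤ δ) :
    ‖scalarMap D f * p‖ ≤ δ := by
  rw [ContinuousMap.norm_le _ hδ]
  intro x
  have h0 : 0 ≤ f x := hf0 x
  have e : (scalarMap D f * p) x = f x • p x := by simp [Algebra.algebraMap_eq_smul_one]
  rw [e, norm_smul, Real.norm_of_nonneg h0]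
  by_cases hx : f x = 0
  · simpa [hx] using hδ
  · calc f x * ‖p x‖ ≤ 1 * δ := by gcongr; exacts [hf1 x, hp x hx]
      _ = δ := one_mul δ

end Bump

/-- Cutting down a positive element of norm more than `r`. -/
theorem IsPosElem.exists_cutoff {D : Type*} [CStarAlgebra D] {d : D} (hd : IsPosElem d) {r : ℝ}
    (hr : 0 ≤ r) (hrd : r < ‖d‖) :
    ∃ e : D, star e = e ∧ e ≠ 0 ∧ IsPosElem (e * d * e - r • (e * e)) := by
  let _ := CStarAlgebra.spectralOrder D
  have _ := CStarAlgebra.spectralOrderedRing D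
  rw [isPosElem_iff_nonneg] at hd
  set g : ℝ → ℝ := fun t => max (t - r) 0 with hg
  have hsa : IsSelfAdjoint d := .of_nonneg hd
  refine ⟨cfc g d, (cfc_predicate g d : IsSelfAdjoint _).star_eq, fun h0 => ?_, ?_⟩
  · rw [← cfc_zero ℝ d, cfc_eq_cfc_iff_eqOn] at h0
    refine absurd ?_ (not_le.2 hrd)
    rw [← cfc_id' ℝ d]
    refine norm_cfc_le hr fun x hx => ?_
    rw [Real.norm_of_nonneg (spectrum_nonneg_of_nonneg hd hx)]
    have := h0 hx
    simp only [hg, Pi.zero_apply, max_eq_right_iff] at this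
    linarith
  · have e1 : cfc g d * d * cfc g d - r • (cfc g d * cfc g d) =
        cfc (fun t => g t * t * g t - r • (g t * g t)) d := by
      rw [cfc_sub (fun t => g t * t * g t) (fun t => r • (g t * g t)) d,
        cfc_mul (fun t => g t * t) g d, cfc_mul g (fun t => t) d, cfc_id' ℝ d,
        cfc_smul r (fun t => g t * g t) d, cfc_mul g g d]
    rw [isPosElem_iff_nonneg, e1]
    refine cfc_nonneg fun x _ => ?_
    rcases le_total (x - r) 0 with h | h
    · simp [hg, max_eq_right h]
    · simp only [hg, max_eq_left h, smul_eq_mul]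
      have : (x - r) * x * (x - r) - r * ((x - r) * (x - r)) = (x - r) ^ 2 * (x - r) := by ring
      rw [this]; positivity

namespace CovariantRep

variable {X : Type*} [TopologicalSpace X] [CompactSpace X]
  {D : Type*} [CStarAlgebra D] {h : X ≃ₜ X} {α : C(X, D) ≃⋆ₐ[ℂ] C(X, D)}
  {A : Type*} [CStarAlgebra A]

theorem ι_scalarMap_mul_self_mul (R : CovariantRep α A) (f : C(X, ℝ)) (g : C(X, D)) :
    R.ι (scalarMap D (f * f) * g) = R.scalar f * R.ι g * R.scalar f := by
  rw [map_mul, map_mul, map_mul, ← scalar, mul_assoc, scalar_commute, ← mul_assoc, scalar_commute]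

/-- If a positive `y` is locally close to a constant `d`, then it dominates some `φ ⊗ a`. -/
theorem exists_cuntzSubeq_of_norm_le (R : CovariantRep α A) {B : StarSubalgebra ℂ A}
    (hBc : IsClosed (B : Set A)) (hBι : ∀ f, R.ι f ∈ B) {y : A} (hyB : y ∈ B) (hy : IsPosElem y)
    {d : D} (hd : IsPosElem d) {δ : ℝ} (hδ : 0 < δ) (hδd : 2 * δ < ‖d‖) {f k : C(X, ℝ)}
    (hkf : k * f = k) (hk : k ≠ 0)
    (hle : ‖R.scalar f * y * R.scalar f - R.ι (scalarMap D (f * f) * constMap X d)‖ ≤ δ) :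
    ∃ (φ : C(X, ℝ)) (a : D), 0 ≤ φ ∧ φ ≠ 0 ∧ IsPosElem a ∧ a ≠ 0 ∧
      CuntzSubeq B (R.ι (scalarMap D φ * constMap X a)) y := by
  -- Here `e d e ≥ 2δ e²`. Compressing `y` by `w = e k` loses at most `δ w w*`, which leaves `w y w*
  -- ≥ δ k² e²`.
  obtain ⟨e, hes, he0, he⟩ := hd.exists_cutoff (by positivity) hδd
  have hee : IsPosElem (e * e) := ⟨e, by rw [hes]⟩
  have hφ0 : 0 ≤ k * k := fun x => mul_self_nonneg (k x)
  have hee0 : e * e ≠ 0 := fun h0 => he0 (by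
    rw [← CStarRing.star_mul_self_eq_zero_iff, hes, h0])
  refine ⟨k * k, δ • (e * e), hφ0, fun h0 => hk ?_, hee.smul hδ.le,
    smul_ne_zero hδ.ne' hee0, ?_⟩
  · ext x
    have := DFunLike.congr_fun h0 x
    simpa using this
  set w := R.ι (constMap X e) * R.scalar k with hw
  have hws : star w = R.ι (constMap X e) * R.scalar k := by
    rw [hw, star_mul, star_scalar, ← map_star, ← map_star, hes, scalar_commute]
  have hwB : w ∈ B := mul_mem (hBι _) (hBι _)
  have hwf : w * R.scalar f = w := by rw [hw, mul_assoc, ← scalar_mul, hkf]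
  have hfw : R.scalar f * star w = star w := by
    rw [hws, ← mul_assoc, scalar_commute, mul_assoc, ← scalar_mul, mul_comm f k, hkf]
  have hyw : w * y * star w = w * (R.scalar f * y * R.scalar f) * star w := by
    calc _ = (w * R.scalar f) * y * (R.scalar f * star w) := by rw [hwf, hfw]
      _ = _ := by noncomm_ring
  have hin : R.ι (scalarMap D (f * f) * constMap X d) = R.scalar f * R.ι (constMap X d) *
      R.scalar f :=
    R.ι_scalarMap_mul_self_mul f _
  have hs : star (R.scalar f * y * R.scalar f - R.ι (scalarMap D (f * f) * constMap X d)) =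
      R.scalar f * y * R.scalar f - R.ι (scalarMap D (f * f) * constMap X d) := by
    rw [hin]
    simp only [star_sub, star_mul, star_scalar, hy.star_eq, ← map_star, hd.star_eq, mul_assoc]
  have h1 := (isPosElem_add_of_norm_le hs hle).conj w
  have h2 := ((he.map (constMap X)).map R.ι).conj (R.scalar k)
  refine (cuntzSubeq_of_le hBc (hBι _) (mul_mem (mul_mem hwB hyB) (star_mem hwB)) ?_ ?_).trans
    (cuntzSubeq_conj hwB y)
  · rw [ι_scalarMap_mul_self_mul]
    simpa using (((hee.smul hδ.le).map (constMap X)).map R.ι).conj (R.scalar k)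
  · convert! h1.add h2 using 1
    have hwd : w * R.ι (scalarMap D (f * f) * constMap X d) * star w =
        R.scalar k * R.ι (constMap X (e * d * e)) * R.scalar k := by
      calc _ = (w * R.scalar f) * R.ι (constMap X d) * (R.scalar f * star w) := by
            rw [hin]; noncomm_ring
        _ = R.ι (constMap X e) * R.scalar k * R.ι (constMap X d) *
            (R.ι (constMap X e) * R.scalar k) := by
            rw [hwf, hfw, hws]
        _ = _ := by
            rw [← mul_assoc _ (R.ι (constMap X e)), ← R.scalar_commute k (constMap X e)]
            simp only [map_mul, mul_assoc]
    have hww : w * star w = R.scalar k * R.ι (constMap X (e * e)) * R.scalar k := by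
      rw [hws, hw, ← mul_assoc _ (R.ι (constMap X e)), ← R.scalar_commute k (constMap X e)]
      simp only [map_mul, mul_assoc]
    have hsm : ∀ (r : ℝ) (a : D), R.ι (constMap X (r • a)) = r • R.ι (constMap X a) := fun r a => by
      rw [← Complex.coe_smul, map_smul, map_smul, Complex.coe_smul]
    rw [ι_scalarMap_mul_self_mul, star_scalar, mul_add, add_mul, mul_sub, sub_mul, ← hyw, hwd, mul_smul_comm, mul_one,
      smul_mul_assoc, hww, map_sub, map_sub, hsm, hsm, mul_sub, sub_mul, mul_smul_comm,
      mul_smul_comm, smul_mul_assoc, smul_mul_assoc]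
    module

theorem breaks_empty_top (R : CovariantRep α A) : R.Breaks ∅ ⊤ :=
  ⟨by simp, fun _ => trivial, fun _ _ => trivial⟩

variable [T2Space X] [Infinite X]

/-- A closed ideal containing a nonzero `φ ⊗ a` contains the unit. -/
theorem one_mem_of_mem (R : CovariantRep α A) (hD : IsSimpleCStar D) (hmin : IsMinimalHomeo h)
    (hper : IsPseudoperiodicallyGenerated h α) {φ : C(X, ℝ)} (hφ : 0 ≤ φ) (hφ0 : φ ≠ 0) {a : D}
    (ha : IsPosElem a) (ha0 : a ≠ 0) (I : TwoSidedIdeal A) (hI : IsClosed {x : A | x ∈ I})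
    (hmem : R.ι (scalarMap D φ * constMap X a) ∈ I) : (1 : A) ∈ I := by
  obtain ⟨x₀⟩ : Nonempty X := inferInstance
  -- With `Y = ∅` and `B = ⊤` every orbit misses `Y`, so any point can serve as `x₀`.
  obtain ⟨V, hV, hxV, hVc⟩ := R.breaks_empty_top.exists_nhd_scalar_cuntzSubeq hD hmin hper
    isClosed_empty (x₀ := x₀) (fun _ => id) hφ hφ0 ha ha0
  obtain ⟨G, hG0, -, hGV, W, hW, hxW, hG1⟩ := exists_bump hV hxV
  have hGI : R.scalar G ∈ I := (hVc G hG0 hGV).mem_ideal I hI hmem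
  obtain ⟨m, hm⟩ := hmin.exists_window hW ⟨x₀, hxW⟩
  -- Every orbit meets `W` within `m` steps, so this sum of translates of `G` is at least `1`, hence
  -- invertible.
  let H : C(X, ℝ) := ∑ t ∈ Finset.Ico (0 : ℤ) m, G.comp ((h ^ t : X ≃ₜ X) : C(X, X))
  have hH : ∀ x, 1 ≤ H x := fun x => by
    obtain ⟨t, ht0, htm, htW⟩ := hm 0 x
    have : G ((h ^ t) x) ≤ H x := by
      simp only [H, ContinuousMap.sum_apply]
      exact Finset.single_le_sum (f := fun t : ℤ => G ((h ^ t) x)) (fun s _ => hG0 _)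
        (Finset.mem_Ico.2 ⟨ht0, by omega⟩)
    rwa [hG1 _ htW] at this
  have hHI : R.scalar H ∈ I := by
    simp only [H, scalar, map_sum]
    refine sum_mem fun t _ => ?_
    have : R.ι (scalarMap D (G.comp ((h ^ t : X ≃ₜ X) : C(X, X)))) =
        R.pow (-t) * R.scalar G * R.pow t := by
      rw [R.pow_mul_scalar hper.liesOver, neg_neg, mul_assoc, ← pow_add, neg_add_cancel,
        pow_zero, mul_one, scalar]
    rw [this]
    exact I.mul_mem_right _ _ (I.mul_mem_left _ _ hGI)
  let H' : C(X, ℝ) := ⟨fun x => (H x)⁻¹, H.continuous.inv₀ fun x => by linarith [hH x]⟩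
  have : H * H' = 1 := by
    ext x
    exact mul_inv_cancel₀ (by linarith [hH x])
  rw [← R.scalar_one, ← this, scalar_mul]
  exact I.mul_mem_right _ _ hHI

/-- If `p` is in the kernel, so is `q = p* p`. Near a point where `q ≠ 0`, the element `0 = ι q` is
close to a nonzero constant, so it dominates some `φ ⊗ a` with `φ, a ≠ 0`. Then the zero ideal
contains `1`. -/
theorem ι_injective [Nontrivial A] (R : CovariantRep α A) (hD : IsSimpleCStar D)
    (hmin : IsMinimalHomeo h) (hper : IsPseudoperiodicallyGenerated h α) :
    Function.Injective R.ι := by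
  rw [injective_iff_map_eq_zero]
  intro p hp
  by_contra hp0
  obtain ⟨z, hz⟩ : ∃ z, p z ≠ 0 := by
    by_contra! hne
    exact hp0 (ContinuousMap.ext hne)
  set q := star p * p with hq
  have hqz : q z ≠ 0 := fun h0 => hz (CStarRing.star_mul_self_eq_zero_iff _ |>.1 h0)
  have hq0 : R.ι q = 0 := by rw [hq, map_mul, hp, mul_zero]
  set δ := ‖q z‖ / 3 with hδ
  have hδ0 : 0 < δ := by positivity
  obtain ⟨f, hf0, hf1, hfV, W, hW, hzW, hfW⟩ := exists_bump
    (isOpen_lt (f := fun x => ‖q z - q x‖) (by fun_prop) continuous_const : IsOpen {x | _ < δ})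
    (x := z) (by simpa using hδ0)
  obtain ⟨k, hk0, hk1, hkW, W', -, hzW', hkW'⟩ := exists_bump hW hzW
  have hkf : k * f = k := by
    ext x
    by_cases hx : x ∈ W
    · simp [hfW x hx]
    · simp [hkW x hx]
  obtain ⟨φ, a, hφ, hφ0, ha, ha0, hc⟩ := R.exists_cuntzSubeq_of_norm_le (B := ⊤) (y := 0)
    (by simp) (fun _ => trivial) trivial isPosElem_zero (d := q z) ⟨p z, rfl⟩ hδ0
    (by rw [hδ]; linarith [norm_pos_iff.2 hqz]) hkf
    (fun h0 => by have := hkW' z hzW'; simp [h0] at this) (by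
      have e : R.scalar f * 0 * R.scalar f - R.ι (scalarMap D (f * f) * constMap X (q z)) =
          -R.ι (scalarMap D (f * f) * (constMap X (q z) - q)) := by
        rw [mul_sub, map_sub, map_mul R.ι _ q, hq0]; simp
      rw [e, norm_neg]
      refine (NonUnitalStarAlgHom.norm_apply_le R.ι _).trans
        (norm_scalarMap_mul_le (f := f * f) (fun x => mul_self_nonneg (f x)) (fun x => ?_) hδ0.le fun x hx => ?_)
      · exact mul_le_one₀ (hf1 x) (hf0 x) (hf1 x)
      · by_contra hlt
        refine hx ?_
        simp [hfV x fun hx' : ‖q z - q x‖ < δ => hlt hx'.le])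
  have := R.one_mem_of_mem hD hmin hper hφ hφ0 ha ha0 ⊥
    (by simp only [TwoSidedIdeal.mem_bot, Set.ofPred_eq_eq_singleton]; exact isClosed_singleton)
    (hc.mem_ideal ⊥
      (by simp only [TwoSidedIdeal.mem_bot, Set.ofPred_eq_eq_singleton]; exact isClosed_singleton)
      (zero_mem _))
  rw [TwoSidedIdeal.mem_bot] at this
  exact one_ne_zero this

end CovariantRep

/-! ### Finite sums `∑ f uⁿ` and the expectation obtained by averaging the gauge action. -/

namespace CovariantRep

section Span

variable {C : Type*} [CStarAlgebra C] {α : C ≃⋆ₐ[ℂ] C} {A : Type*} [CStarAlgebra A]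

/-- The finite sums `∑ ι (f n) U ^ n`. -/
noncomputable def polys (R : CovariantRep α A) : Submodule ℂ A :=
  Submodule.span ℂ {a | ∃ (f : C) (n : ℤ), a = R.ι f * R.pow n}

theorem mem_polys (R : CovariantRep α A) (f : C) (n : ℤ) : R.ι f * R.pow n ∈ R.polys :=
  Submodule.subset_span ⟨f, n, rfl⟩

theorem ι_mem_polys (R : CovariantRep α A) (f : C) : R.ι f ∈ R.polys := by
  simpa using R.mem_polys f 0

theorem mul_mem_polys (R : CovariantRep α A) {a b : A} (ha : a ∈ R.polys) (hb : b ∈ R.polys) :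
    a * b ∈ R.polys := by
  induction ha using Submodule.span_induction with
  | zero => simp
  | add x y _ _ hx hy => rw [add_mul]; exact add_mem hx hy
  | smul c x _ hx => rw [smul_mul_assoc]; exact Submodule.smul_mem _ _ hx
  | mem x hx =>
    obtain ⟨f, n, rfl⟩ := hx
    induction hb using Submodule.span_induction with
    | zero => simp
    | add x y _ _ hx hy => rw [mul_add]; exact add_mem hx hy
    | smul c x _ hx => rw [mul_smul_comm]; exact Submodule.smul_mem _ _ hx
    | mem x hx =>
      obtain ⟨g, m, rfl⟩ := hx
      have : R.ι f * R.pow n * (R.ι g * R.pow m) = R.ι (f * (α ^ n) g) * R.pow (n + m) := by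
        rw [mul_assoc, ← mul_assoc (R.pow n), R.pow_mul_ι, map_mul, pow_add]
        noncomm_ring
      rw [this]
      exact R.mem_polys _ _

theorem star_mem_polys (R : CovariantRep α A) {a : A} (ha : a ∈ R.polys) :
    star a ∈ R.polys := by
  induction ha using Submodule.span_induction with
  | zero => simp
  | add x y _ _ hx hy => rw [star_add]; exact add_mem hx hy
  | smul c x _ hx => rw [star_smul]; exact Submodule.smul_mem _ _ hx
  | mem x hx =>
    obtain ⟨f, n, rfl⟩ := hx
    rw [star_mul, star_pow, ← map_star, R.pow_mul_ι]
    exact R.mem_polys _ _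

theorem adjoin_subset_polys (R : CovariantRep α A) {a : A}
    (ha : a ∈ StarAlgebra.adjoin ℂ (Set.range R.ι ∪ {(R.U : A)})) : a ∈ R.polys := by
  induction ha using StarAlgebra.adjoin_induction with
  | mem x hx =>
    rcases hx with ⟨f, rfl⟩ | rfl
    · exact R.ι_mem_polys f
    · simpa [R.pow_one] using R.mem_polys 1 1
  | algebraMap r =>
    rw [← AlgHomClass.commutes R.ι]
    exact R.ι_mem_polys _
  | add x y _ _ hx hy => exact add_mem hx hy
  | mul x y _ _ hx hy => exact R.mul_mem_polys hx hy
  | star x _ hx => exact R.star_mem_polys hx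

theorem pow_mem (R : CovariantRep α A) {S : StarSubalgebra ℂ A} (hU : (R.U : A) ∈ S) (n : ℤ) :
    R.pow n ∈ S := by
  have hnat : ∀ k : ℕ, R.pow k ∈ S := fun k => by
    induction k with
    | zero => simp
    | succ k ih => push_cast; rw [pow_add, pow_one]; exact mul_mem ih hU
  obtain ⟨k, rfl | rfl⟩ := n.eq_nat_or_neg
  · exact hnat k
  · rw [← star_pow]; exact star_mem (hnat k)

theorem polys_subset (R : CovariantRep α A) {S : StarSubalgebra ℂ A} (hι : ∀ f, R.ι f ∈ S)
    (hU : (R.U : A) ∈ S) {a : A} (ha : a ∈ R.polys) : a ∈ S := by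
  induction ha using Submodule.span_induction with
  | zero => exact zero_mem _
  | add x y _ _ hx hy => exact add_mem hx hy
  | smul c x _ hx => exact S.smul_mem hx c
  | mem x hx =>
    obtain ⟨f, n, rfl⟩ := hx
    exact mul_mem (hι f) (R.pow_mem hU n)

end Span

section Expectation

open MeasureTheory Complex

variable {X : Type*} [TopologicalSpace X] [CompactSpace X]
  {D : Type*} [CStarAlgebra D] {h : X ≃ₜ X} {α : C(X, D) ≃⋆ₐ[ℂ] C(X, D)}
  {A : Type*} [CStarAlgebra A]

theorem integral_exp_int_mul {n : ℤ} (hn : n ≠ 0) :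
    ∫ θ in (-Real.pi)..Real.pi, exp (n * I * θ) = 0 := by
  rw [integral_exp_mul_complex (mul_ne_zero (by exact_mod_cast hn) I_ne_zero)]
  have : exp (n * I * (Real.pi : ℝ)) = exp (n * I * ((-Real.pi : ℝ) : ℂ)) := by
    rw [exp_eq_exp_iff_exists_int]
    exact ⟨n, by push_cast; ring⟩
  rw [this, sub_self, zero_div]

/-- A continuous positive function with vanishing integral over `[-π, π]` vanishes at `0`. -/
theorem eq_zero_of_integral_eq_zero {G : ℝ → A} (hG : Continuous G) (hpos : ∀ θ, IsPosElem (G θ))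
    (h0 : ∫ θ in (-Real.pi)..Real.pi, G θ = 0) : G 0 = 0 := by
  let _ := CStarAlgebra.spectralOrder A
  have _ := CStarAlgebra.spectralOrderedRing A
  have hpi := Real.pi_pos
  have hint : ∀ a b, IntervalIntegrable G volume a b := fun a b => hG.intervalIntegrable a b
  have hnn : ∀ a b, a ≤ b → 0 ≤ ∫ θ in a..b, G θ := fun a b hab => by
    rw [intervalIntegral.integral_of_le hab]
    exact integral_nonneg fun θ => isPosElem_iff_nonneg.1 (hpos θ)
  -- Positivity squeezes every partial integral to `0`. The integrand at `0` is the derivative of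
  -- this vanishing antiderivative.
  have hF : ∀ r ∈ Set.Ioo (-Real.pi) Real.pi, ∫ θ in (-Real.pi)..r, G θ = 0 := by
    intro r hr
    refine le_antisymm ?_ (hnn _ _ hr.1.le)
    have := intervalIntegral.integral_add_adjacent_intervals (hint (-Real.pi) r) (hint r Real.pi)
    rw [h0] at this
    rw [eq_neg_of_add_eq_zero_left this]
    exact neg_nonpos.2 (hnn _ _ hr.2.le)
  have hd := intervalIntegral.integral_hasDerivAt_right (hint (-Real.pi) 0)
    (hG.stronglyMeasurableAtFilter _ _) hG.continuousAt
  have hd' : HasDerivAt (fun r => ∫ θ in (-Real.pi)..r, G θ) 0 0 :=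
    (hasDerivAt_const (0 : ℝ) (0 : A)).congr_of_eventuallyEq
      (Filter.eventually_of_mem (Ioo_mem_nhds (by linarith) hpi) hF)
  exact hd.unique hd'

/-- If `A` is the closure of the finite sums `∑ ι (f n) U ^ n`, and has a gauge action `T`, then
every nonzero positive `y` has a nonzero positive zeroth coefficient `p`, and `f y f` is close to
`f p f` for all scalar `f` whose support is disjoint from sufficiently many of its translates. -/
theorem exists_coeff (R : CovariantRep α A) (hα : LiesOver h α)
    (hdense : ∀ a : A, a ∈ closure (R.polys : Set A)) (hι : Function.Injective R.ι)
    {A' : Type*} [CStarAlgebra A'] (T : ℝ → A →⋆ₐ[ℂ] A') (hT0 : Function.Injective (T 0))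
    (hT : ∀ θ f n, T θ (R.ι f * R.pow n) = exp (n * I * θ) • T 0 (R.ι f * R.pow n))
    {y : A} (hy : IsPosElem y) (hy0 : y ≠ 0) :
    ∃ p : C(X, D), IsPosElem p ∧ p ≠ 0 ∧ ∀ δ : ℝ, 0 < δ → ∃ N : ℕ, ∀ f : C(X, ℝ), 0 ≤ f →
      (∀ x, f x ≤ 1) → (∀ n : ℤ, n ≠ 0 → |n| ≤ N → ∀ x, f x = 0 ∨ f ((h ^ n) x) = 0) →
      ‖R.scalar f * y * R.scalar f - R.ι (scalarMap D (f * f) * p)‖ ≤ δ := by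
  have hTn : ∀ θ a, ‖T θ a‖ ≤ ‖a‖ := fun θ a => NonUnitalStarAlgHom.norm_apply_le (T θ) a
  have hcont0 : ∀ a ∈ R.polys, Continuous fun θ => T θ a := fun a ha => by
    induction ha using Submodule.span_induction with
    | zero => simpa using continuous_const
    | add x y _ _ hx hy => simp_rw [map_add]; exact hx.add hy
    | smul c x _ hx => simp_rw [map_smul]; exact hx.const_smul c
    | mem x hx =>
      obtain ⟨f, n, rfl⟩ := hx
      rw [funext fun θ => hT θ f n]
      fun_prop
  have hcont : ∀ a, Continuous fun θ => T θ a := fun a => by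
    refine continuous_of_uniform_approx_of_continuous fun u hu => ?_
    obtain ⟨ε, hε, hu⟩ := Metric.mem_uniformity_dist.1 hu
    obtain ⟨b, hb, hab⟩ := Metric.mem_closure_iff.1 (hdense a) ε hε
    refine ⟨fun θ => T θ b, hcont0 b hb, fun θ => hu ?_⟩
    rw [dist_eq_norm, ← map_sub]
    exact (hTn _ _).trans_lt (by rwa [← dist_eq_norm])
  have hint : ∀ a, IntervalIntegrable (fun θ => T θ a) volume (-Real.pi) Real.pi :=
    fun a => (hcont a).intervalIntegrable _ _
  -- The averaged gauge action: a contraction that keeps the zeroth coefficient of a finite sum.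
  let E : A → A' := fun a => (2 * Real.pi)⁻¹ • ∫ θ in (-Real.pi)..Real.pi, T θ a
  have hEadd : ∀ a b, E (a + b) = E a + E b := fun a b => by
    simp only [E, map_add]
    rw [intervalIntegral.integral_add (hint a) (hint b), smul_add]
  have hEsmul : ∀ (c : ℂ) a, E (c • a) = c • E a := fun c a => by
    simp only [E, map_smul]
    rw [intervalIntegral.integral_smul, smul_comm]
  have hEsub : ∀ a b, E (a - b) = E a - E b := fun a b => by
    rw [sub_eq_add_neg, hEadd, ← neg_one_smul ℂ b, hEsmul, neg_one_smul, ← sub_eq_add_neg]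
  have hpi := Real.pi_pos
  have hEn : ∀ a, ‖E a‖ ≤ ‖a‖ := fun a => by
    have := intervalIntegral.norm_integral_le_of_norm_le_const (a := -Real.pi) (b := Real.pi)
      (f := fun θ => T θ a) (C := ‖a‖) fun θ _ => hTn θ a
    simp only [E]
    rw [norm_smul, Real.norm_of_nonneg (by positivity), inv_mul_le_iff₀ (by positivity)]
    refine this.trans_eq ?_
    rw [abs_of_nonneg (by linarith)]; ring
  -- For `n ≠ 0` the integral kills `g uⁿ`, and `f (g uⁿ) f` contains the factor `f · (f ∘ h⁻ⁿ) =
  -- 0`. So both operations see only the zeroth coefficient.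
  have hpoly : ∀ b ∈ R.polys, ∃ (p : C(X, D)) (N : ℕ), E b = T 0 (R.ι p) ∧
      ∀ f : C(X, ℝ), (∀ n : ℤ, n ≠ 0 → |n| ≤ N → ∀ x, f x = 0 ∨ f ((h ^ n) x) = 0) →
        R.scalar f * b * R.scalar f = R.ι (scalarMap D (f * f) * p) := fun b hb => by
    induction hb using Submodule.span_induction with
    | zero => exact ⟨0, 0, by simp [E], by simp⟩
    | add x y _ _ hx hy =>
      obtain ⟨p, N, hp, hN⟩ := hx
      obtain ⟨q, M, hq, hM⟩ := hy
      refine ⟨p + q, max N M, by rw [hEadd, hp, hq, map_add, map_add], fun f hf => ?_⟩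
      rw [mul_add, add_mul, mul_add, map_add,
        hN f fun n hn hnN => hf n hn (hnN.trans (by simp)),
        hM f fun n hn hnN => hf n hn (hnN.trans (by simp))]
    | smul c x _ hx =>
      obtain ⟨p, N, hp, hN⟩ := hx
      refine ⟨c • p, N, by rw [hEsmul, hp, map_smul, map_smul], fun f hf => ?_⟩
      rw [mul_smul_comm, smul_mul_assoc, hN f hf, mul_smul_comm, map_smul]
    | mem x hx =>
      obtain ⟨g, n, rfl⟩ := hx
      by_cases hn : n = 0
      · subst hn
        refine ⟨g, 0, ?_, fun f _ => ?_⟩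
        · simp only [E]
          rw [funext fun θ => hT θ g 0]
          simp only [pow_zero, mul_one, Int.cast_zero, zero_mul, exp_zero, one_smul,
            intervalIntegral.integral_const, sub_neg_eq_add, smul_smul]
          rw [← two_mul, inv_mul_cancel₀ (by positivity), one_smul]
        · rw [pow_zero, mul_one, ι_scalarMap_mul_self_mul]
      · refine ⟨0, n.natAbs, ?_, fun f hf => ?_⟩
        · simp only [E]
          rw [funext fun θ => hT θ g n, intervalIntegral.integral_smul_const, integral_exp_int_mul hn]
          simp
        · rw [mul_zero, map_zero, mul_assoc, mul_assoc, R.pow_mul_scalar hα, ← mul_assoc,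
            scalar_commute, mul_assoc, ← mul_assoc (R.scalar f), ← scalar_mul]
          have : f * f.comp ((h ^ (-n) : X ≃ₜ X) : C(X, X)) = 0 := by
            ext x
            rcases hf (-n) (neg_ne_zero.2 hn) (by simp) x with h0 | h0
            · simp [h0]
            · rw [ContinuousMap.mul_apply, ContinuousMap.comp_apply, ContinuousMap.coe_coe, h0,
                mul_zero, ContinuousMap.zero_apply]
          rw [this, scalar, map_zero, map_zero, zero_mul, mul_zero]
  let J : C(X, D) →⋆ₐ[ℂ] A' := (T 0).comp R.ι
  have hJ : Function.Injective J := hT0.comp hι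
  have hJn : ∀ p, ‖J p‖ = ‖p‖ := NonUnitalStarAlgHom.norm_map J hJ
  -- `E` sends finite sums into the range of `J`, which is closed because `J` is isometric.
  have hEJ : E y ∈ Set.range J := by
    have hcl : IsClosed (Set.range J) :=
      (NonUnitalStarAlgHom.isometry J hJ).isClosedEmbedding.isClosed_range
    refine hcl.closure_eq ▸ Metric.mem_closure_iff.2 fun ε hε => ?_
    obtain ⟨b, hb, hab⟩ := Metric.mem_closure_iff.1 (hdense y) ε hε
    obtain ⟨p, N, hp, -⟩ := hpoly b hb
    refine ⟨E b, ⟨p, hp.symm⟩, ?_⟩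
    rw [dist_eq_norm, ← hEsub]
    exact (hEn _).trans_lt (by rwa [← dist_eq_norm])
  obtain ⟨p, hp⟩ := hEJ
  refine ⟨p, ?_, fun h0 => ?_, fun δ hδ => ?_⟩
  · refine IsPosElem.of_map J hJ ?_
    rw [hp]
    refine IsPosElem.smul ?_ (by positivity)
    let _ := CStarAlgebra.spectralOrder A'
    have _ := CStarAlgebra.spectralOrderedRing A'
    rw [isPosElem_iff_nonneg, intervalIntegral.integral_of_le (by linarith)]
    exact integral_nonneg fun θ => isPosElem_iff_nonneg.1 (hy.map (T θ))
  -- Faithfulness: a vanishing average of the positive elements `T θ y` forces `T 0 y = 0`.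
  · rw [h0, map_zero] at hp
    have h1 := (smul_eq_zero.1 hp.symm).resolve_left (by positivity)
    have h2 := eq_zero_of_integral_eq_zero (hcont y) (fun θ => hy.map (T θ)) h1
    exact hy0 (hT0 (by rw [h2, map_zero]))
  -- One `δ / 2` pays for replacing `y` by the finite sum `b`, the other for replacing `p` by the
  -- coefficient `q` of `b`, as `E` is contractive.
  · obtain ⟨b, hb, hab⟩ := Metric.mem_closure_iff.1 (hdense y) (δ / 2) (by positivity)
    rw [dist_eq_norm] at hab
    obtain ⟨q, N, hq, hN⟩ := hpoly b hb
    refine ⟨N, fun f hf0 hf1 hf => ?_⟩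
    have hqp : ‖q - p‖ ≤ δ / 2 := by
      calc ‖q - p‖ = ‖J q - J p‖ := by rw [← map_sub, hJn]
        _ = ‖E (b - y)‖ := by rw [hp, hEsub, hq]; rfl
        _ ≤ ‖b - y‖ := hEn _
        _ ≤ δ / 2 := by rw [norm_sub_rev]; exact hab.le
    have hfn : ‖R.scalar f‖ ≤ 1 := by
      refine (NonUnitalStarAlgHom.norm_apply_le R.ι _).trans ?_
      rw [ContinuousMap.norm_le _ zero_le_one]
      intro x
      have h0 : 0 ≤ f x := hf0 x
      rcases subsingleton_or_nontrivial D with hs | hs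
      · rw [Subsingleton.elim (scalarMap D f x) 0, norm_zero]; exact zero_le_one
      · rw [scalarMap_apply, norm_algebraMap', Real.norm_of_nonneg h0]; exact hf1 x
    have e : R.scalar f * y * R.scalar f - R.ι (scalarMap D (f * f) * p) =
        R.scalar f * (y - b) * R.scalar f + R.ι (scalarMap D (f * f) * (q - p)) := by
      rw [mul_sub (scalarMap D (f * f)), map_sub, ← hN f hf]; noncomm_ring
    rw [e]
    have h1 : ‖R.scalar f * (y - b) * R.scalar f‖ ≤ δ / 2 := by
      calc _ ≤ ‖R.scalar f‖ * ‖y - b‖ * ‖R.scalar f‖ :=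
            (norm_mul_le _ _).trans (by gcongr; exact norm_mul_le _ _)
        _ ≤ 1 * (δ / 2) * 1 := by gcongr
        _ = δ / 2 := by ring
    have h2 : ‖R.ι (scalarMap D (f * f) * (q - p))‖ ≤ δ / 2 :=
      (NonUnitalStarAlgHom.norm_apply_le R.ι _).trans
        (norm_scalarMap_mul_le (f := f * f) (fun x => mul_self_nonneg (f x))
          (fun x => mul_le_one₀ (hf1 x) (hf0 x) (hf1 x)) (by positivity)
          fun x _ => ((q - p).norm_coe_le_norm x).trans hqp)
    calc _ ≤ _ := norm_add_le _ _
      _ ≤ δ := by linarith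

end Expectation

end CovariantRep

/-! ### Simplicity from nonzero coefficients. -/

namespace CovariantRep

section Simple

variable {X : Type*} [TopologicalSpace X] [CompactSpace X]
  {D : Type*} [CStarAlgebra D] {h : X ≃ₜ X} {α : C(X, D) ≃⋆ₐ[ℂ] C(X, D)}
  {A : Type*} [CStarAlgebra A]

/-- Every nonzero positive element has a nonzero positive zeroth coefficient. -/
def HasCoeffs (R : CovariantRep α A) (h : X ≃ₜ X) : Prop :=
  ∀ y : A, IsPosElem y → y ≠ 0 →
    ∃ p : C(X, D), IsPosElem p ∧ p ≠ 0 ∧ ∀ δ : ℝ, 0 < δ → ∃ N : ℕ, ∀ f : C(X, ℝ), 0 ≤ f →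
      (∀ x, f x ≤ 1) → (∀ n : ℤ, n ≠ 0 → |n| ≤ N → ∀ x, f x = 0 ∨ f ((h ^ n) x) = 0) →
      ‖R.scalar f * y * R.scalar f - R.ι (scalarMap D (f * f) * p)‖ ≤ δ

variable [T2Space X] [Infinite X]

/-- Points are not periodic, so a bump function at a point `z` with `p z ≠ 0` can have support
disjoint from many translates. It compresses `y` to nearly the constant `p z`. -/
theorem HasCoeffs.exists_cuntzSubeq {R : CovariantRep α A} (hR : R.HasCoeffs h)
    (hmin : IsMinimalHomeo h) {B : StarSubalgebra ℂ A} (hBc : IsClosed (B : Set A))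
    (hBι : ∀ f, R.ι f ∈ B) {y : A} (hyB : y ∈ B) (hy : IsPosElem y) (hy0 : y ≠ 0) :
    ∃ (φ : C(X, ℝ)) (a : D), 0 ≤ φ ∧ φ ≠ 0 ∧ IsPosElem a ∧ a ≠ 0 ∧
      CuntzSubeq B (R.ι (scalarMap D φ * constMap X a)) y := by
  obtain ⟨p, hp, hp0, hpN⟩ := hR y hy hy0
  obtain ⟨z, hz⟩ : ∃ z, p z ≠ 0 := by
    by_contra! hne
    exact hp0 (ContinuousMap.ext hne)
  have hn := norm_pos_iff.2 hz
  -- The error is `2δ`: `δ` from the coefficient and `δ` from the variation of `p`. The cut-down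
  -- needs twice that, `4δ`, below `‖p z‖`.
  set δ := ‖p z‖ / 5 with hδ
  have hδ0 : 0 < δ := by positivity
  obtain ⟨N, hN⟩ := hpN δ hδ0
  obtain ⟨W, hW, hzW, hWd⟩ := exists_isOpen_disjoint_translates (h := h)
    (isCompact_singleton (x := z))
    (fun k hk y hy => by
      rw [Set.mem_singleton_iff] at hy
      rw [hy]
      exact hmin.zpow_apply_ne hk z) N
  obtain ⟨f, hf0, hf1, hfV, V, hV, hzV, hfV1⟩ := exists_bump
    ((isOpen_lt (f := fun x => ‖p x - p z‖) (by fun_prop) continuous_const :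
      IsOpen {x | _ < δ}).inter hW) (x := z) ⟨by simpa using hδ0, hzW rfl⟩
  obtain ⟨k, -, -, hkV, W', -, hzW', hkW'⟩ := exists_bump hV hzV
  have hkf : k * f = k := by
    ext x
    by_cases hx : x ∈ V
    · simp [hfV1 x hx]
    · simp [hkV x hx]
  have hpz : IsPosElem (p z) := by
    obtain ⟨s, rfl⟩ := hp
    exact ⟨s z, rfl⟩
  have hf' : ∀ x, f x ≠ 0 → ‖p x - p z‖ < δ ∧ x ∈ W := fun x hx => not_imp_comm.1 (hfV x) hx
  refine R.exists_cuntzSubeq_of_norm_le hBc hBι hyB hy hpz (δ := 2 * δ) (by positivity)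
    (by rw [hδ]; linarith) hkf (fun h0 => by have := hkW' z hzW'; simp [h0] at this) ?_
  have e : R.scalar f * y * R.scalar f - R.ι (scalarMap D (f * f) * constMap X (p z)) =
      (R.scalar f * y * R.scalar f - R.ι (scalarMap D (f * f) * p)) +
        R.ι (scalarMap D (f * f) * (p - constMap X (p z))) := by
    rw [mul_sub, map_sub]; abel
  rw [e, two_mul]
  refine (norm_add_le _ _).trans (add_le_add (hN f hf0 hf1 fun n hn hnN x => ?_)
    ((NonUnitalStarAlgHom.norm_apply_le R.ι _).trans
      (norm_scalarMap_mul_le (f := f * f) (fun x => mul_self_nonneg (f x))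
        (fun x => mul_le_one₀ (hf1 x) (hf0 x) (hf1 x)) hδ0.le fun x hx => ?_)))
  · by_contra! hne
    exact hWd n hn hnN x (hf' x hne.1).2 (hf' _ hne.2).2
  · exact (hf' x fun h0 => hx (by simp [h0])).1.le

theorem HasCoeffs.isSimple [Nontrivial A] {R : CovariantRep α A} (hR : R.HasCoeffs h)
    (hD : IsSimpleCStar D) (hmin : IsMinimalHomeo h)
    (hper : IsPseudoperiodicallyGenerated h α) : IsSimpleCStar A := by
  refine ⟨inferInstance, fun I hI => or_iff_not_imp_left.2 fun hbot => ?_⟩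
  obtain ⟨a, ha, ha0⟩ : ∃ a ∈ I, a ≠ 0 := by
    by_contra! hne
    refine hbot (le_antisymm (fun x hx => ?_) bot_le)
    rw [TwoSidedIdeal.mem_bot]
    exact hne x hx
  obtain ⟨φ, b, hφ, hφ0, hb, hb0, hc⟩ := hR.exists_cuntzSubeq hmin (B := ⊤) (by simp)
    (fun _ => trivial) trivial (isPosElem_star_mul_self a)
    (fun h0 => ha0 (CStarRing.star_mul_self_eq_zero_iff _ |>.1 h0))
  have h1 := R.one_mem_of_mem hD hmin hper hφ hφ0 hb hb0 I hI
    (hc.mem_ideal I hI (I.mul_mem_left _ _ ha))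
  rw [← top_le_iff]
  intro x _
  simpa using I.mul_mem_left x 1 h1

end Simple

end CovariantRep

/-! ### The canonical covariant representation in the crossed product -/

namespace CovariantPair

variable {A : Type w} [CStarAlgebra A] (α : A ≃⋆ₐ[ℂ] A)

/-- The universal covariant representation in the product of all covariant pairs. -/
noncomputable def prodRep : CovariantRep α (Prod α) where
  ι :=
    { toFun := coeff α
      map_one' := by ext i; exact map_one i.φ
      map_mul' := fun a b => by ext i; exact map_mul i.φ a b
      map_zero' := by ext i; exact map_zero i.φ
      map_add' := fun a b => by ext i; exact map_add i.φ a b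
      commutes' := fun r => by ext i; exact AlgHomClass.commutes i.φ r
      map_star' := fun a => by ext i; exact map_star i.φ a }
  U := ⟨unit α, by
    rw [Unitary.mem_iff]
    constructor <;> ext i
    · exact (Unitary.mem_iff.1 i.unitary_u).1
    · exact (Unitary.mem_iff.1 i.unitary_u).2⟩
  cov := fun a => by
    ext i
    change i.u * i.φ a = i.φ (α a) * i.u
    rw [← i.covariant, mul_assoc, (Unitary.mem_iff.1 i.unitary_u).1, mul_one]

variable {α}

/-- A covariant pair, with its unitary multiplied by `exp (i θ)`. -/
noncomputable def twist (θ : ℝ) (i : CovariantPair α) : CovariantPair α where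
  E := i.E
  φ := i.φ
  u := Complex.exp (θ * Complex.I) • i.u
  unitary_u := by
    have h1 : star (Complex.exp (θ * Complex.I)) * Complex.exp (θ * Complex.I) = 1 := by
      rw [Complex.star_def, ← Complex.exp_conj, ← Complex.exp_add]
      simp
    have hu := Unitary.mem_iff.1 i.unitary_u
    rw [Unitary.mem_iff, star_smul]
    constructor
    · rw [smul_mul_smul_comm, h1, hu.1, one_smul]
    · rw [smul_mul_smul_comm, mul_comm, h1, hu.2, one_smul]
  covariant a := by
    have h1 : star (Complex.exp (θ * Complex.I)) * Complex.exp (θ * Complex.I) = 1 := by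
      rw [Complex.star_def, ← Complex.exp_conj, ← Complex.exp_add]
      simp
    rw [star_smul, smul_mul_assoc, smul_mul_smul_comm, mul_comm, h1, one_smul, i.covariant]

/-- The gauge action on the product of all covariant pairs. -/
noncomputable def gauge (α : A ≃⋆ₐ[ℂ] A) (θ : ℝ) : Prod α →⋆ₐ[ℂ] Prod α where
  toFun a := ⟨fun i => a (i.twist θ), memℓp_infty ⟨‖a‖, by
    rintro _ ⟨i, rfl⟩
    exact lp.norm_apply_le_norm ENNReal.top_ne_zero a (i.twist θ)⟩⟩
  map_one' := rfl
  map_mul' _ _ := rfl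
  map_zero' := rfl
  map_add' _ _ := rfl
  commutes' _ := rfl
  map_star' _ := rfl

end CovariantPair

namespace CovariantPair

variable {A : Type w} [CStarAlgebra A] (α : A ≃⋆ₐ[ℂ] A)

theorem twist_zero (i : CovariantPair α) : i.twist 0 = i := by
  obtain ⟨E, φ, u, hu, hc⟩ := i
  simp [twist]

theorem gauge_zero (a : Prod α) : gauge α 0 a = a := by
  ext i
  -- Twisting by `0` returns `i` only up to a propositional equality, so the two components have a
  -- priori different types.
  have : ∀ j, j = i → HEq (a j) (a i) := fun j hj => by rw [hj]
  exact eq_of_heq (this _ i.twist_zero)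

theorem gauge_ι (θ : ℝ) (f : A) : gauge α θ ((prodRep α).ι f) = (prodRep α).ι f := rfl

theorem gauge_U (θ : ℝ) :
    gauge α θ (prodRep α).U = Complex.exp (θ * Complex.I) • ((prodRep α).U : Prod α) := rfl

theorem gauge_pow (θ : ℝ) (n : ℤ) :
    gauge α θ ((prodRep α).pow n) = Complex.exp (n * Complex.I * θ) • (prodRep α).pow n := by
  have hnat : ∀ k : ℕ, gauge α θ ((prodRep α).pow k) =
      Complex.exp (k * Complex.I * θ) • (prodRep α).pow k := fun k => by
    induction k with
    | zero => simp
    | succ k ih =>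
      push_cast
      rw [CovariantRep.pow_add, map_mul, ih, CovariantRep.pow_one, gauge_U, smul_mul_smul_comm,
        ← Complex.exp_add]
      congr 2
      ring
  obtain ⟨k, rfl | rfl⟩ := n.eq_nat_or_neg
  · exact_mod_cast hnat k
  · rw [← CovariantRep.star_pow, map_star, hnat, star_smul, CovariantRep.star_pow,
      Complex.star_def, ← Complex.exp_conj]
    congr 2
    simp

end CovariantPair

namespace CrossedProduct

variable {A : Type w} [CStarAlgebra A] (α : A ≃⋆ₐ[ℂ] A)

/-- The inclusion of the crossed product in the product of all covariant pairs. -/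
noncomputable def incl : CrossedProduct α →⋆ₐ[ℂ] CovariantPair.Prod α :=
  (CovariantPair.algebra α).subtype

theorem incl_injective : Function.Injective (incl α) := Subtype.val_injective

/-- The canonical covariant representation in the crossed product. -/
noncomputable def rep : CovariantRep α (CrossedProduct α) where
  ι :=
    { toFun := ι α
      map_one' := incl_injective α (map_one (CovariantPair.prodRep α).ι)
      map_mul' := fun a b => incl_injective α (map_mul (CovariantPair.prodRep α).ι a b)
      map_zero' := incl_injective α (map_zero (CovariantPair.prodRep α).ι)
      map_add' := fun a b => incl_injective α (map_add (CovariantPair.prodRep α).ι a b)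
      commutes' := fun r => incl_injective α (AlgHomClass.commutes (CovariantPair.prodRep α).ι r)
      map_star' := fun a => incl_injective α (map_star (CovariantPair.prodRep α).ι a) }
  U := ⟨u α, by
    have := Unitary.mem_iff.1 (CovariantPair.prodRep α).U.2
    rw [Unitary.mem_iff]
    exact ⟨incl_injective α this.1, incl_injective α this.2⟩⟩
  cov := fun a => incl_injective α ((CovariantPair.prodRep α).cov a)

theorem incl_ι (a : A) : incl α ((rep α).ι a) = (CovariantPair.prodRep α).ι a := rfl

theorem incl_U : incl α (rep α).U = (CovariantPair.prodRep α).U := rfl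

theorem incl_pow (n : ℤ) : incl α ((rep α).pow n) = (CovariantPair.prodRep α).pow n := by
  have hnat : ∀ k : ℕ, incl α ((rep α).pow k) = (CovariantPair.prodRep α).pow k := fun k => by
    induction k with
    | zero => simp
    | succ k ih =>
      push_cast
      rw [CovariantRep.pow_add, map_mul, ih, CovariantRep.pow_one, incl_U,
        CovariantRep.pow_add, CovariantRep.pow_one]
  obtain ⟨k, rfl | rfl⟩ := n.eq_nat_or_neg
  · exact hnat k
  · rw [← CovariantRep.star_pow, map_star, hnat, CovariantRep.star_pow]

/-- The finite sums `∑ ι (f n) u ^ n` are dense in the crossed product. -/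
theorem mem_closure_polys (a : CrossedProduct α) :
    a ∈ closure ((rep α).polys : Set (CrossedProduct α)) := by
  rw [Metric.mem_closure_iff]
  intro ε hε
  have ha : incl α a ∈ closure (StarAlgebra.adjoin ℂ
      (Set.range (CovariantPair.coeff α) ∪ {CovariantPair.unit α}) :
        Set (CovariantPair.Prod α)) := a.2
  obtain ⟨b, hb, hab⟩ := Metric.mem_closure_iff.1 ha ε hε
  have hb' : b ∈ (CovariantPair.prodRep α).polys :=
    (CovariantPair.prodRep α).adjoin_subset_polys hb
  have hmap : (CovariantPair.prodRep α).polys ≤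
      Submodule.map (incl α).toAlgHom.toLinearMap (rep α).polys := by
    rw [CovariantRep.polys, Submodule.span_le]
    rintro _ ⟨f, n, rfl⟩
    refine ⟨(rep α).ι f * (rep α).pow n, (rep α).mem_polys f n, ?_⟩
    change incl α ((rep α).ι f * (rep α).pow n) = _
    rw [map_mul, incl_pow, incl_ι]
  obtain ⟨c, hc, rfl⟩ := hmap hb'
  exact ⟨c, hc, hab⟩

theorem cstarGenerated_eq_top {S : Set (CrossedProduct α)} (hι : ∀ f, ι α f ∈ S)
    (hu : u α ∈ S) : cstarGenerated S = ⊤ := by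
  rw [← top_le_iff]
  intro a _
  have hS : S ⊆ cstarGenerated S := fun x hx =>
    StarSubalgebra.le_topologicalClosure _ (StarAlgebra.subset_adjoin ℂ _ hx)
  have hcl : IsClosed (cstarGenerated S : Set (CrossedProduct α)) :=
    StarSubalgebra.isClosed_topologicalClosure _
  exact closure_minimal (fun x hx => (rep α).polys_subset (fun f => hS (hι f)) (hS hu) hx) hcl
    (mem_closure_polys α a)

/-- The gauge action, with values in the product of all covariant pairs. -/
noncomputable def gauge (θ : ℝ) : CrossedProduct α →⋆ₐ[ℂ] CovariantPair.Prod α :=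
  (CovariantPair.gauge α θ).comp (incl α)

theorem gauge_zero_injective : Function.Injective (gauge α 0) := fun a b hab =>
  incl_injective α (by simpa [gauge, CovariantPair.gauge_zero] using hab)

theorem gauge_apply (θ : ℝ) (f : A) (n : ℤ) : gauge α θ ((rep α).ι f * (rep α).pow n) =
    Complex.exp (n * Complex.I * θ) • gauge α 0 ((rep α).ι f * (rep α).pow n) := by
  simp only [gauge, StarAlgHom.comp_apply, CovariantPair.gauge_zero]
  rw [map_mul, map_mul, incl_pow, incl_ι, CovariantPair.gauge_ι, CovariantPair.gauge_pow,
    mul_smul_comm]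

end CrossedProduct

section OrbitBreaking

variable {X : Type*} [TopologicalSpace X] [CompactSpace X] {D : Type*} [CStarAlgebra D]
  {h : X ≃ₜ X} {α : C(X, D) ≃⋆ₐ[ℂ] C(X, D)}

theorem breaks_orbitBreaking (Y : Set X) : (CrossedProduct.rep α).Breaks Y (orbitBreaking α Y) where
  isClosed := StarSubalgebra.isClosed_topologicalClosure _
  ι_mem f := StarSubalgebra.le_topologicalClosure _
    (StarAlgebra.subset_adjoin ℂ _ (Or.inl ⟨f, rfl⟩))
  mul_U_mem f hf := StarSubalgebra.le_topologicalClosure _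
    (StarAlgebra.subset_adjoin ℂ _ (Or.inr ⟨f, hf, rfl⟩))

theorem CrossedProduct.hasCoeffs (hα : LiesOver h α)
    (hι : Function.Injective (CrossedProduct.rep α).ι) : (CrossedProduct.rep α).HasCoeffs h :=
  fun _ hy hy0 => (CrossedProduct.rep α).exists_coeff hα (CrossedProduct.mem_closure_polys α) hι
    (CrossedProduct.gauge α) (CrossedProduct.gauge_zero_injective α) (CrossedProduct.gauge_apply α)
    hy hy0

end OrbitBreaking

/-! ### The regular representation -/

section Regular

variable {H : Type*} [NormedAddCommGroup H] [InnerProductSpace ℂ H]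

/-- The diagonal operator on `ℓ²(ℤ, H)` given by a bounded family of operators. -/
noncomputable def diagOp (T : ℤ → H →L[ℂ] H) (M : ℝ) (hT : ∀ n, ‖T n‖ ≤ M) :
    lp (fun _ : ℤ => H) 2 →L[ℂ] lp (fun _ : ℤ => H) 2 :=
  have hb : ∀ (ξ : lp (fun _ : ℤ => H) 2) (n : ℤ), ‖T n (ξ n)‖ ≤ ‖((M : ℂ) • ξ) n‖ := fun ξ n => by
    rw [lp.coeFn_smul, Pi.smul_apply, norm_smul, Complex.norm_real, Real.norm_eq_abs]
    exact ((T n).le_opNorm _).trans (by gcongr; exact (hT n).trans (le_abs_self M))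
  LinearMap.mkContinuous
    { toFun := fun ξ => ⟨fun n => T n (ξ n), (lp.memℓp ((M : ℂ) • ξ)).mono' (hb ξ)⟩
      map_add' := fun ξ η => by ext n; exact map_add (T n) _ _
      map_smul' := fun c ξ => by ext n; simp } M fun ξ => by
    have hM : 0 ≤ M := (norm_nonneg _).trans (hT 0)
    have := lp.norm_mono (p := 2) (by norm_num)
      (x := ⟨fun n => T n (ξ n), (lp.memℓp ((M : ℂ) • ξ)).mono' (hb ξ)⟩) (hb ξ)
    rwa [norm_smul, Complex.norm_real, Real.norm_of_nonneg hM] at this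

theorem diagOp_apply (T : ℤ → H →L[ℂ] H) (M : ℝ) (hT : ∀ n, ‖T n‖ ≤ M)
    (ξ : lp (fun _ : ℤ => H) 2) (n : ℤ) : diagOp T M hT ξ n = T n (ξ n) := rfl

/-- The shift on `ℓ²(ℤ, H)`. -/
noncomputable def shiftOp (H : Type*) [NormedAddCommGroup H] [InnerProductSpace ℂ H] (k : ℤ) :
    lp (fun _ : ℤ => H) 2 →L[ℂ] lp (fun _ : ℤ => H) 2 :=
  have hs : ∀ ξ : lp (fun _ : ℤ => H) 2, Memℓp (fun n : ℤ => ξ (n - k)) 2 := fun ξ =>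
    memℓp_gen ((Equiv.subRight k).summable_iff.2 ((lp.memℓp ξ).summable (by norm_num)))
  LinearMap.mkContinuous
    { toFun := fun ξ => ⟨fun n => ξ (n - k), hs ξ⟩
      map_add' := fun ξ η => rfl
      map_smul' := fun c ξ => rfl } 1 fun ξ => by
    rw [one_mul]
    refine lp.norm_le_of_tsum_le (by norm_num) (norm_nonneg _) ?_
    rw [lp.norm_rpow_eq_tsum (by norm_num)]
    exact ((Equiv.subRight k).tsum_eq fun n => ‖ξ n‖ ^ (2 : ℝ≥0∞).toReal).le

theorem shiftOp_apply (k : ℤ) (ξ : lp (fun _ : ℤ => H) 2) (n : ℤ) :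
    shiftOp H k ξ n = ξ (n - k) := rfl

theorem shiftOp_mul_shiftOp_neg (k : ℤ) : shiftOp H k * shiftOp H (-k) = 1 := by
  ext ξ n
  change ξ (n - k - -k) = ξ n
  rw [sub_neg_eq_add, sub_add_cancel]

variable [CompleteSpace H]

theorem star_diagOp (T : ℤ → H →L[ℂ] H) (M : ℝ) (hT : ∀ n, ‖T n‖ ≤ M)
    (hT' : ∀ n, ‖star (T n)‖ ≤ M) :
    diagOp (fun n => star (T n)) M hT' = star (diagOp T M hT) := by
  refine (ContinuousLinearMap.eq_adjoint_iff _ _).2 fun ξ η => ?_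
  rw [lp.inner_eq_tsum, lp.inner_eq_tsum]
  exact tsum_congr fun n => ContinuousLinearMap.adjoint_inner_left (T n) (η n) (ξ n)

theorem star_shiftOp (k : ℤ) : shiftOp H (-k) = star (shiftOp H k) := by
  refine (ContinuousLinearMap.eq_adjoint_iff _ _).2 fun ξ η => ?_
  rw [lp.inner_eq_tsum, lp.inner_eq_tsum, ← (Equiv.subRight k).tsum_eq]
  refine tsum_congr fun n => ?_
  simp [shiftOp_apply]

/-- The covariant pair on `ℓ²(ℤ, H)` induced from a representation on `H`. -/
noncomputable def regularPair {H : Type w} [NormedAddCommGroup H] [InnerProductSpace ℂ H]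
    [CompleteSpace H] [Nontrivial H] {C : Type w} [CStarAlgebra C] (α : C ≃⋆ₐ[ℂ] C)
    (π : C →⋆ₐ[ℂ] (H →L[ℂ] H)) : CovariantPair α :=
  have hπ : ∀ (a : C) (n : ℤ), ‖π ((α ^ (-n)) a)‖ ≤ ‖a‖ := fun a n =>
    (NonUnitalStarAlgHom.norm_apply_le π _).trans
      (NonUnitalStarAlgHom.norm_apply_le ((α ^ (-n) : C ≃⋆ₐ[ℂ] C) : C →⋆ₐ[ℂ] C) a)
  { E := lp (fun _ : ℤ => H) 2 →L[ℂ] lp (fun _ : ℤ => H) 2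
    nontriv := by
      obtain ⟨v, hv⟩ := exists_ne (0 : H)
      have : Nontrivial (lp (fun _ : ℤ => H) 2) := ⟨lp.single 2 0 v, 0, fun h0 => hv (by
        simpa using congrArg (fun ξ : lp (fun _ : ℤ => H) 2 => ξ 0) h0)⟩
      infer_instance
    φ :=
      { toFun := fun a => diagOp (fun n => π ((α ^ (-n)) a)) ‖a‖ (hπ a)
        map_one' := by ext ξ n; simp [diagOp_apply]
        map_mul' := fun a b => by ext ξ n; simp [diagOp_apply]
        map_zero' := by ext ξ n; simp [diagOp_apply]
        map_add' := fun a b => by ext ξ n; simp [diagOp_apply]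
        commutes' := fun r => by
          ext ξ n
          simp [diagOp_apply, Algebra.algebraMap_eq_smul_one]
        map_star' := fun a => by
          rw [← star_diagOp _ _ _ fun n => by rw [norm_star]; exact hπ a n]
          ext ξ n
          rw [diagOp_apply, diagOp_apply, map_star, map_star] }
    u := shiftOp H 1
    unitary_u := by
      rw [Unitary.mem_iff, ← star_shiftOp]
      refine ⟨?_, shiftOp_mul_shiftOp_neg 1⟩
      simpa using shiftOp_mul_shiftOp_neg (H := H) (-1)
    covariant := fun a => by
      rw [← star_shiftOp]
      ext ξ n
      change π ((α ^ (-(n - 1))) a) (ξ (n - 1 - -1)) = π ((α ^ (-n)) (α a)) (ξ n)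
      rw [sub_neg_eq_add, sub_add_cancel, show -(n - 1) = -n + 1 by ring, zpow_add, zpow_one]
      rfl }

end Regular

/-! ### Representations at a point of `X` and nearly norm-preserving cut-downs. -/

section State

universe v

/-- The hypothesis makes `(a - c) b` a null vector for every `b`, and the classes of the `b` are
dense. -/
theorem gns_apply_eq_smul {C : Type*} [CStarAlgebra C] [PartialOrder C] [StarOrderedRing C]
    (ω : C →ₚ[ℂ] ℂ) (a : C) (c : ℂ) (h : ∀ b, ω (star ((a - c • 1) * b) * ((a - c • 1) * b)) = 0)
    (v : ω.GNS) : ω.gnsStarAlgHom a v = c • v := by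
  have hz : ∀ v : ω.GNS, ω.gnsStarAlgHom (a - c • 1) v = 0 := fun v => by
    induction v using UniformSpace.Completion.induction_on with
    | hp => exact isClosed_eq (ContinuousLinearMap.continuous _) continuous_const
    | ih b =>
      have e1 : ω.gnsStarAlgHom (a - c • 1) (b : ω.GNS) =
          ((ω.toPreGNS ((a - c • 1) * ω.ofPreGNS b) : ω.PreGNS) : ω.GNS) :=
        ω.gnsNonUnitalStarAlgHom_apply_coe
      rw [e1, ← norm_eq_zero, UniformSpace.Completion.norm_coe]
      have h2 := ω.preGNS_norm_sq (ω.toPreGNS ((a - c • 1) * ω.ofPreGNS b))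
      rw [ω.ofPreGNS_toPreGNS, h] at h2
      exact_mod_cast pow_eq_zero_iff (two_ne_zero) |>.1 h2
  have := hz v
  rw [map_sub, map_smul, map_one] at this
  exact sub_eq_zero.1 this

/-- A tracial state on `D` yields, for each `x`, a representation of `C(X, D)` on a Hilbert space
in which the scalar functions act by their values at `x`. -/
theorem HasTracialState.exists_rep {X : Type v} [TopologicalSpace X] [CompactSpace X] {D : Type w}
    [CStarAlgebra D] (hτ : HasTracialState D) (x : X) :
    ∃ (H : Type (max v w)) (_ : NormedAddCommGroup H) (_ : InnerProductSpace ℂ H)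
      (_ : CompleteSpace H) (_ : Nontrivial H) (π : C(X, D) →⋆ₐ[ℂ] (H →L[ℂ] H)),
      ∀ (f : C(X, ℝ)) (v : H), π (scalarMap D f) v = (f x : ℂ) • v := by
  obtain ⟨τ, hτ0, hτ1, -⟩ := hτ
  let _ := CStarAlgebra.spectralOrder C(X, D)
  have _ := CStarAlgebra.spectralOrderedRing C(X, D)
  -- The GNS space of `τ` composed with evaluation at `x`: there `f - f(x)` acts as zero because it
  -- vanishes at `x`.
  let ω : C(X, D) →ₚ[ℂ] ℂ := PositiveLinearMap.mk₀
    { toFun := fun f => τ (f x)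
      map_add' := fun f g => by simp
      map_smul' := fun c f => by simp } fun f hf => by
    obtain ⟨s, rfl⟩ := isPosElem_iff_nonneg.2 hf
    exact hτ0 (s x)
  have hω : ∀ f, ω f = τ (f x) := fun _ => rfl
  have hnt : Nontrivial ω.GNS := by
    refine ⟨(ω.toPreGNS 1 : ω.GNS), 0, fun h0 => ?_⟩
    have h1 : ‖ω.toPreGNS 1‖ = 0 := by rw [← UniformSpace.Completion.norm_coe, h0, norm_zero]
    have h2 := ω.preGNS_norm_sq (ω.toPreGNS 1)
    rw [h1, hω] at h2
    simp [hτ1] at h2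
  refine ⟨ω.GNS, inferInstance, inferInstance, inferInstance, hnt, ω.gnsStarAlgHom, fun f =>
    gns_apply_eq_smul ω _ _ fun b => ?_⟩
  have : (scalarMap D f - (f x : ℂ) • 1) x = 0 := by simp [Algebra.algebraMap_eq_smul_one]
  rw [hω, ContinuousMap.mul_apply, ContinuousMap.mul_apply, this, zero_mul, mul_zero, map_zero]

/-- A representation in which cutting down by `1 - g` hardly decreases the norm of a given
operator, as long as `g` vanishes at sufficiently many points of an orbit. -/
theorem HasTracialState.exists_covariantPair {X : Type v} [TopologicalSpace X] [CompactSpace X]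
    {D : Type w} [CStarAlgebra D] (hτ : HasTracialState D) {h : X ≃ₜ X}
    {α : C(X, D) ≃⋆ₐ[ℂ] C(X, D)} (hα : LiesOver h α) (x₀ : X) :
    ∃ i : CovariantPair α, ∀ (a : i.E) (ε : ℝ), 0 < ε → ∃ S : Finset ℤ, ∀ g : C(X, ℝ), 0 ≤ g →
      (∀ x, g x ≤ 1) → (∀ n ∈ S, g ((h ^ n) x₀) = 0) →
      ‖a‖ - ε < ‖(1 - i.φ (scalarMap D g)) * a * (1 - i.φ (scalarMap D g))‖ := by
  obtain ⟨H, _, _, _, _, π, hπ⟩ := hτ.exists_rep x₀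
  refine ⟨regularPair α π, fun (a : lp (fun _ : ℤ => H) 2 →L[ℂ] lp (fun _ : ℤ => H) 2) ε hε => ?_⟩
  let φ : C(X, D) →⋆ₐ[ℂ] (lp (fun _ : ℤ => H) 2 →L[ℂ] lp (fun _ : ℤ => H) 2) :=
    (regularPair α π).φ
  have hφ : ∀ (g : C(X, ℝ)) (ξ : lp (fun _ : ℤ => H) 2) (n : ℤ),
      φ (scalarMap D g) ξ n = (g ((h ^ n) x₀) : ℂ) • ξ n := fun g ξ n => by
    change π ((α ^ (-n)) (scalarMap D g)) (ξ n) = _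
    rw [hα.zpow_scalarMap, hπ, neg_neg]
    rfl
  have hle : ∀ g : C(X, ℝ), 0 ≤ g → (∀ x, g x ≤ 1) → ∀ ξ, ‖φ (scalarMap D g) ξ‖ ≤ ‖ξ‖ :=
    fun g hg0 hg1 ξ => lp.norm_mono (by norm_num) fun n => by
      have h0 : 0 ≤ g ((h ^ n) x₀) := hg0 _
      rw [hφ, norm_smul, Complex.norm_real, Real.norm_of_nonneg h0]
      exact mul_le_of_le_one_left (norm_nonneg _) (hg1 _)
  have htail : ∀ (ζ : lp (fun _ : ℤ => H) 2) (δ : ℝ), 0 < δ → ∃ S : Finset ℤ, ∀ g : C(X, ℝ),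
      0 ≤ g → (∀ x, g x ≤ 1) → (∀ n ∈ S, g ((h ^ n) x₀) = 0) → ‖φ (scalarMap D g) ζ‖ < δ := by
    intro ζ δ hδ
    obtain ⟨S, hS⟩ := (Metric.tendsto_nhds.1 (lp.hasSum_single (by norm_num) ζ) δ hδ).exists
    refine ⟨S, fun g hg0 hg1 hg => ?_⟩
    have hz : φ (scalarMap D g) (∑ n ∈ S, lp.single 2 n (ζ n)) = 0 := by
      ext n
      rw [hφ]
      by_cases hn : n ∈ S
      · simp [hg n hn]
      · have : (∑ m ∈ S, lp.single 2 m (ζ m) : lp (fun _ : ℤ => H) 2) n = 0 := by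
          rw [lp.coeFn_sum, Finset.sum_apply]
          refine Finset.sum_eq_zero fun m hm => ?_
          rw [lp.single_apply_ne]
          exact fun h => hn (h ▸ hm)
        rw [this, smul_zero]
        rfl
    calc ‖φ (scalarMap D g) ζ‖ = ‖φ (scalarMap D g) (ζ - ∑ n ∈ S, lp.single 2 n (ζ n))‖ := by
          rw [map_sub, hz, sub_zero]
      _ ≤ ‖ζ - ∑ n ∈ S, lp.single 2 n (ζ n)‖ := hle g hg0 hg1 _
      _ < δ := by rwa [← dist_eq_norm, dist_comm]
  change ∃ S : Finset ℤ, ∀ g : C(X, ℝ), 0 ≤ g → (∀ x, g x ≤ 1) →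
    (∀ n ∈ S, g ((h ^ n) x₀) = 0) →
    ‖a‖ - ε < ‖(1 - φ (scalarMap D g)) * a * (1 - φ (scalarMap D g))‖
  by_cases hneg : ‖a‖ - ε < 0
  · exact ⟨∅, fun g _ _ _ => hneg.trans_le (norm_nonneg _)⟩
  -- Both `ξ` and `a ξ` are nearly supported on finitely many coordinates, and `g` is made to vanish
  -- at the corresponding orbit points.
  obtain ⟨ξ, hξ, hξa⟩ := a.exists_lt_apply_of_lt_opNorm
    (show ‖a‖ - ε / 3 < ‖a‖ by linarith)
  have hM : 0 < ‖a‖ + 1 := by positivity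
  obtain ⟨S₁, hS₁⟩ := htail ξ (ε / 3 / (‖a‖ + 1)) (by positivity)
  obtain ⟨S₂, hS₂⟩ := htail (a ξ) (ε / 3) (by positivity)
  refine ⟨S₁ ∪ S₂, fun g hg0 hg1 hg => ?_⟩
  have h1 := hS₁ g hg0 hg1 fun n hn => hg n (Finset.mem_union_left _ hn)
  have h2 := hS₂ g hg0 hg1 fun n hn => hg n (Finset.mem_union_right _ hn)
  have hle' : ∀ ξ, ‖(1 - φ (scalarMap D g)) ξ‖ ≤ ‖ξ‖ := fun ξ => by
    have := hle (1 - g) (fun x => sub_nonneg.2 (hg1 x)) (fun x => by simpa using hg0 x) ξ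
    rwa [map_sub, map_sub, map_one, map_one] at this
  set p := φ (scalarMap D g)
  have h3 : ‖(1 - p) (a (p ξ))‖ < ε / 3 := by
    refine ((hle' _).trans (a.le_opNorm _)).trans_lt ?_
    calc ‖a‖ * ‖p ξ‖ ≤ (‖a‖ + 1) * ‖p ξ‖ := by gcongr; linarith
      _ < (‖a‖ + 1) * (ε / 3 / (‖a‖ + 1)) := by gcongr
      _ = ε / 3 := by field_simp
  have e : a ξ = ((1 - p) * a * (1 - p)) ξ + p (a ξ) + (1 - p) (a (p ξ)) := by
    simp only [mul_apply_eq_comp, sub_apply,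
      one_apply_eq_self, map_sub]
    abel
  have h4 : ‖((1 - p) * a * (1 - p)) ξ‖ ≤ ‖(1 - p) * a * (1 - p)‖ :=
    ((1 - p) * a * (1 - p)).unit_le_opNorm ξ hξ.le
  have h5 := norm_add₃_le (a := ((1 - p) * a * (1 - p)) ξ) (b := p (a ξ)) (c := (1 - p) (a (p ξ)))
  rw [← e] at h5
  linarith

end State

/-! ### Large subalgebras -/

theorem IsSimpleCStar.injective {A E : Type*} [CStarAlgebra A] [CStarAlgebra E] [Nontrivial E]
    (hA : IsSimpleCStar A) (π : A →⋆ₐ[ℂ] E) : Function.Injective π := by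
  have hcont : Continuous π := AddMonoidHomClass.continuous_of_bound π 1 fun a => by
    rw [one_mul]
    exact NonUnitalStarAlgHom.norm_apply_le π a
  have hcl : IsClosed {a : A | a ∈ TwoSidedIdeal.ker π} := by
    simp only [TwoSidedIdeal.mem_ker]
    exact isClosed_singleton.preimage hcont
  rcases hA.2 _ hcl with h0 | h1
  · rw [injective_iff_map_eq_zero]
    intro a ha
    rw [← TwoSidedIdeal.mem_ker, h0, TwoSidedIdeal.mem_bot] at ha
    exact ha
  · have : (1 : A) ∈ TwoSidedIdeal.ker π := h1 ▸ trivial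
    rw [TwoSidedIdeal.mem_ker, map_one] at this
    exact absurd this one_ne_zero

/-- By Tietze, evaluation at any finite set of points is onto, so the dimension exceeds every bound.
-/
theorem not_finiteDimensional_continuousMap (X : Type*) [TopologicalSpace X] [NormalSpace X]
    [T1Space X] [Infinite X] : ¬ FiniteDimensional ℝ C(X, ℝ) := by
  intro hfd
  obtain ⟨T, hT⟩ := Infinite.exists_subset_card_eq X (Module.finrank ℝ C(X, ℝ) + 1)
  let L : C(X, ℝ) →ₗ[ℝ] (↥(T : Set X) → ℝ) :=
    { toFun := fun f x => f x
      map_add' := fun _ _ => rfl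
      map_smul' := fun _ _ => rfl }
  have hL : Function.Surjective L := fun v => by
    obtain ⟨g, hg⟩ := ContinuousMap.exists_restrict_eq T.finite_toSet.isClosed
      (⟨v, continuous_of_discreteTopology⟩ : C((T : Set X), ℝ))
    exact ⟨g, funext fun x => DFunLike.congr_fun hg x⟩
  have h1 := LinearMap.finrank_le_finrank_of_surjective hL
  rw [Module.finrank_fintype_fun_eq_card] at h1
  have h2 : Fintype.card (T : Set X) = T.card := by simp
  omega

namespace CovariantRep

variable {X : Type*} [TopologicalSpace X] [CompactSpace X]
  {D : Type*} [CStarAlgebra D] {h : X ≃ₜ X} {α : C(X, D) ≃⋆ₐ[ℂ] C(X, D)}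
  {A : Type*} [CStarAlgebra A] {R : CovariantRep α A} {Y : Set X} {B : StarSubalgebra ℂ A}

theorem not_finiteDimensional [T2Space X] [Infinite X] [Nontrivial D] (R : CovariantRep α A)
    (hι : Function.Injective R.ι) : ¬ FiniteDimensional ℂ A := by
  intro hfd
  have : FiniteDimensional ℝ A := Module.Finite.trans ℂ A
  let L : C(X, ℝ) →ₗ[ℝ] A :=
    { toFun := R.scalar
      map_add' := fun f g => by simp [scalar]
      map_smul' := fun r f => by
        rw [scalar, scalarMap_smul, ← Complex.coe_smul, map_smul, Complex.coe_smul]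
        rfl }
  refine not_finiteDimensional_continuousMap X (Module.Finite.of_injective L fun f g hfg => ?_)
  ext x
  exact (algebraMap ℝ D).injective (DFunLike.congr_fun (hι hfg) x)

/-- A function vanishing on sufficiently many translates of `Y` multiplies a given finite sum into
the orbit breaking subalgebra. -/
theorem Breaks.exists_scalar_mul_mem (hB : R.Breaks Y B) (hα : LiesOver h α) {c : A}
    (hc : c ∈ R.polys) : ∃ N : ℕ, ∀ f : C(X, ℝ), 0 ≤ f →
      (∀ j : ℤ, -N ≤ j → j < N → ∀ y ∈ Y, f ((h ^ j) y) = 0) → R.scalar f * c ∈ B := by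
  induction hc using Submodule.span_induction with
  | mem c hc =>
    obtain ⟨p, n, rfl⟩ := hc
    refine ⟨n.natAbs, fun f hf hv => ?_⟩
    rw [← mul_assoc, scalar_commute, mul_assoc]
    exact mul_mem (hB.ι_mem p) (hB.scalar_mul_pow_mem hα n f hf fun j hj =>
      hv j (by omega) (by omega))
  | zero => exact ⟨0, fun f _ _ => by rw [mul_zero]; exact zero_mem B⟩
  | add a b _ _ ha hb =>
    obtain ⟨N, hN⟩ := ha
    obtain ⟨M, hM⟩ := hb
    refine ⟨max N M, fun f hf hv => ?_⟩
    rw [mul_add]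
    exact add_mem (hN f hf fun j h1 h2 => hv j (by omega) (by omega))
      (hM f hf fun j h1 h2 => hv j (by omega) (by omega))
  | smul r a _ ha =>
    obtain ⟨N, hN⟩ := ha
    refine ⟨N, fun f hf hv => ?_⟩
    rw [mul_smul_comm]
    exact SMulMemClass.smul_mem r (hN f hf hv)

/-- A function equal to `1` on finitely many translates of `Y`, vanishing at finitely many given
points off these translates, and Cuntz subequivalent in `B` to a given bump function. -/
theorem Breaks.exists_scalar_cuntzSubeq [T2Space X] (hB : R.Breaks Y B) (hα : LiesOver h α)
    (hmin : IsMinimalHomeo h) (hY : IsCompact Y) (hd : ∀ n : ℤ, n ≠ 0 → ∀ y ∈ Y, (h ^ n) y ∉ Y)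
    {x₀ : X} (hx₀ : ∀ n : ℤ, (h ^ n) x₀ ∉ Y) {V : Set X} (hV : IsOpen V) (hxV : x₀ ∈ V)
    {G : C(X, ℝ)} (hG : ∀ x ∈ V, G x = 1) (N : ℕ) (S : Finset ℤ) :
    ∃ g : C(X, ℝ), 0 ≤ g ∧ (∀ x, g x ≤ 1) ∧ (∀ n ∈ S, g ((h ^ n) x₀) = 0) ∧
      (∀ j : ℤ, -N ≤ j → j < N → ∀ y ∈ Y, g ((h ^ j) y) = 1) ∧
      CuntzSubeq B (R.scalar g) (R.scalar G) := by
  obtain ⟨p, hp⟩ := hmin.exists_window hV ⟨x₀, hxV⟩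
  have hp0 : 0 < (p : ℤ) := by
    obtain ⟨t, h1, h2, -⟩ := hp 0 x₀
    omega
  -- An index `q` encodes a pair: `k q = ⌊q / p⌋` is the translate of `Y` the piece lies near, and
  -- the residue of `q` selects a time in a window of length `p`. The piece is carried from `h ^ k q
  -- (W)` to `h ^ t q (W)`. The shift by `±N` puts `t q` beyond `k q` on the side away from time
  -- `0`, so no path crosses `Y`, and it keeps `t` injective.
  let κ := Finset.Ico (-(p * N) : ℤ) (p * N)
  let k : κ → ℤ := fun q => q / p
  let t : κ → ℤ := fun q => if 0 ≤ (q : ℤ) then q + N else q - N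
  have hq : ∀ q : κ, -(p * N : ℤ) ≤ q ∧ (q : ℤ) < p * N := fun q => Finset.mem_Ico.1 q.2
  have htinj : ∀ q r : κ, t q = t r → q = r := fun q r hqr => by
    simp only [t] at hqr
    ext
    split_ifs at hqr <;> omega
  have htL : ∀ q : κ, |t q| ≤ p * N + N := fun q => by
    have := hq q
    simp only [t]
    rw [abs_le]
    split_ifs <;> constructor <;> linarith
  have hsign : ∀ q : κ, (0 ≤ k q ∧ k q < t q) ∨ (k q < 0 ∧ t q < k q) := fun q => by
    have h1 := hq q
    simp only [k, t]
    have h4 : -(N : ℤ) ≤ q / p := (Int.le_ediv_iff_mul_le hp0).2 (by linarith)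
    have h5 : (q : ℤ) / p < N := (Int.ediv_lt_iff_lt_mul hp0).2 (by linarith)
    split_ifs with h0
    · exact Or.inl ⟨Int.ediv_nonneg h0 hp0.le, by omega⟩
    · exact Or.inr ⟨Int.ediv_neg_of_neg_of_pos (by omega) hp0, by omega⟩
  -- The bound covers every difference `t s - t q`, so the carried pieces are pairwise disjoint.
  obtain ⟨W, hW, hYW, hWd⟩ := exists_isOpen_disjoint_translates hY hd (2 * (p * N + N))
  let U : κ → Set X := fun q => ((h ^ (-k q)) ⁻¹' W ∩ (h ^ (t q - k q)) ⁻¹' V) ∩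
    (((fun n : ℤ => (h ^ n) x₀) '' S : Set X))ᶜ
  have hU : ∀ q, IsOpen (U q) := fun q =>
    ((hW.preimage (h ^ (-k q)).continuous).inter (hV.preimage (h ^ (t q - k q)).continuous)).inter
      (S.finite_toSet.image _).isClosed.isOpen_compl
  let K : Set X := ⋃ j ∈ Finset.Ico (-N : ℤ) N, (h ^ (-j)) ⁻¹' Y
  have hK : IsClosed K := isClosed_biUnion_finset fun j _ =>
    hY.isClosed.preimage (h ^ (-j)).continuous
  have hKU : K ⊆ ⋃ q, U q := fun x hx => by
    simp only [K, Set.mem_iUnion, Finset.mem_Ico, Set.mem_preimage] at hx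
    obtain ⟨j, ⟨hj1, hj2⟩, hxY⟩ := hx
    -- The window of times reserved for the `j`-th translate. Undoing the shift by `±N` gives the
    -- index `q` in `[p j, p j + p)`.
    obtain ⟨s, hs1, hs2, hsV⟩ := hp (p * j + if 0 ≤ j then (N : ℤ) else -N) ((h ^ (-j)) x)
    obtain ⟨q, hqdef⟩ : ∃ q : ℤ, q = s - if 0 ≤ j then (N : ℤ) else -N := ⟨_, rfl⟩
    have hqj1 : p * j ≤ q := by omega
    have hqj2 : q < p * j + p := by omega
    have hqk : q / p = j :=
      le_antisymm (Int.lt_add_one_iff.1 ((Int.ediv_lt_iff_lt_mul hp0).2 (by linarith)))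
        ((Int.le_ediv_iff_mul_le hp0).2 (by linarith))
    have hqN : q ∈ κ := Finset.mem_Ico.2 ⟨by nlinarith, by nlinarith⟩
    have hkq : k ⟨q, hqN⟩ = j := hqk
    have htq : t ⟨q, hqN⟩ = s := by
      have : 0 ≤ q ↔ 0 ≤ j := by rw [← hqk, Int.ediv_nonneg_iff_of_pos hp0]
      simp only [t, this]
      split_ifs at hqdef ⊢ <;> omega
    refine Set.mem_iUnion.2 ⟨⟨q, hqN⟩, ⟨?_, ?_⟩, ?_⟩
    · rw [hkq]
      exact hYW hxY
    · rw [hkq, htq, Set.mem_preimage, sub_eq_add_neg, h.zpow_add_apply]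
      exact hsV
    · rintro ⟨n, -, rfl⟩
      rw [← h.zpow_add_apply] at hxY
      exact hx₀ _ hxY
  obtain ⟨ψ, hψ⟩ := PartitionOfUnity.exists_isSubordinate_of_locallyFinite hK U hU
    (locallyFinite_of_finite _) hKU
  have hψU : ∀ q x, x ∉ U q → ψ q x = 0 := fun q x hx =>
    image_eq_zero_of_notMem_tsupport fun hx' => hx (hψ q hx')
  choose r hr0 hrψ hrz using fun q => exists_sqrt_fn (f := ψ q) (fun x => ψ.nonneg q x)
  have hrU : ∀ q x, x ∉ U q → r q x = 0 := fun q x hx => hrz q x (hψU q x hx)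
  have hsum : ∀ x, (∑ q, ψ q) x = ∑ᶠ q, ψ q x := fun x => by
    rw [finsum_eq_sum_of_fintype, ContinuousMap.sum_apply]
  refine ⟨∑ q, ψ q, fun x => ?_, fun x => ?_, fun n hn => ?_, fun j hj1 hj2 y hy => ?_, ?_⟩
  · exact (ψ.sum_nonneg x).trans_eq (hsum x).symm
  · rw [hsum]
    exact ψ.sum_le_one x
  · rw [ContinuousMap.sum_apply]
    exact Finset.sum_eq_zero fun q _ => hψU q _ fun hx => hx.2 ⟨n, hn, rfl⟩
  · rw [hsum]
    refine ψ.sum_eq_one (Set.mem_biUnion (Finset.mem_coe.2 (Finset.mem_Ico.2 ⟨hj1, hj2⟩)) ?_)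
    rw [Set.mem_preimage, h.zpow_neg_apply_zpow]
    exact hy
  have hvB : ∑ q, R.ι (scalarMap D (r q)) * R.pow (k q - t q) ∈ B := sum_mem fun q _ =>
    hB.scalar_mul_pow_mem hα _ _ (hr0 q) fun j hj y hy => hrU q _ fun hx => by
      have hxW : (h ^ (-k q)) ((h ^ j) y) ∈ W := hx.1.1
      rw [← h.zpow_add_apply] at hxW
      have h1 := hsign q
      have h2 := abs_le.1 (htL q)
      refine hWd _ ?_ (abs_le.2 ⟨?_, ?_⟩) y (hYW hy) hxW <;> omega
  have hconj := R.sum_conj hα (fun q => k q - t q) (fun q => scalarMap D (r q)) (scalarMap D G)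
    fun q s hqs x => by
      by_contra! hne
      have h1 : (h ^ (k q - t q)) x ∈ U q := by
        by_contra hx
        exact hne.1 (by simp [hrU q _ hx])
      have h2 : (h ^ (k s - t s)) x ∈ U s := by
        by_contra hx
        exact hne.2 (by simp [hrU s _ hx])
      have h1 : (h ^ (-k q)) ((h ^ (k q - t q)) x) ∈ W := h1.1.1
      have h2 : (h ^ (-k s)) ((h ^ (k s - t s)) x) ∈ W := h2.1.1
      rw [← h.zpow_add_apply] at h1 h2
      have h3 := abs_le.1 (htL q)
      have h4 := abs_le.1 (htL s)
      refine hWd (t s - t q) (fun h0 => hqs (htinj _ _ (by omega))) (abs_le.2 ⟨?_, ?_⟩) _ h2 ?_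
      · omega
      · omega
      · rw [← h.zpow_add_apply]
        convert h1 using 3
        ring
  have hterm : ∀ q, scalarMap D (r q) * (α ^ (k q - t q)) (scalarMap D G) *
      star (scalarMap D (r q)) = scalarMap D (ψ q) := fun q => by
    rw [hα.zpow_scalarMap, star_scalarMap, ← map_mul, ← map_mul]
    congr 1
    ext x
    by_cases hx : x ∈ U q
    · have : (h ^ (-(k q - t q))) x ∈ V := by
        rw [neg_sub]
        exact hx.1.2
      have h1 := DFunLike.congr_fun (hrψ q) x
      simp only [ContinuousMap.mul_apply] at h1
      rw [ContinuousMap.mul_apply, ContinuousMap.mul_apply, ContinuousMap.comp_apply,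
        ContinuousMap.coe_coe, hG _ this, mul_one, h1]
    · simp [hrU q x hx, hψU q x hx]
  rw [Finset.sum_congr rfl fun q _ => hterm q, ← map_sum] at hconj
  have := cuntzSubeq_conj hvB (R.scalar G)
  rwa [scalar, hconj] at this

end CovariantRep

/-- The representation of the crossed product given by a covariant pair. -/
noncomputable def CrossedProduct.evalHom {C : Type*} [CStarAlgebra C] {α : C ≃⋆ₐ[ℂ] C}
    (i : CovariantPair α) : CrossedProduct α →⋆ₐ[ℂ] i.E where
  toFun a := incl α a i
  map_one' := rfl
  map_mul' _ _ := rfl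
  map_zero' := rfl
  map_add' _ _ := rfl
  commutes' _ := rfl
  map_star' _ := rfl

theorem CrossedProduct.evalHom_ι {C : Type*} [CStarAlgebra C] {α : C ≃⋆ₐ[ℂ] C}
    (i : CovariantPair α) (a : C) : evalHom i ((rep α).ι a) = i.φ a := rfl

theorem CovariantRep.U_mul_ι_mul_star {C : Type*} [CStarAlgebra C] {α : C ≃⋆ₐ[ℂ] C} {A : Type*}
    [CStarAlgebra A] (R : CovariantRep α A) (f : C) :
    R.U * R.ι f * star (R.U : A) = R.ι (α f) ∧
      star (R.U : A) * R.ι f * R.U = R.ι ((α ^ (-1 : ℤ)) f) := by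
  constructor
  · rw [R.cov, mul_assoc, (Unitary.mem_iff.1 R.U.2).2, mul_one]
  · rw [← R.pow_one, R.star_pow, R.pow_mul_ι, mul_assoc, R.pow_neg_mul_pow, mul_one]

theorem mainTheorem1 {X : Type*} [MetricSpace X] [CompactSpace X] [Infinite X]
    {D : Type*} [CStarAlgebra D] (hD : IsSimpleCStar D) (hτ : HasTracialState D)
    (h : X ≃ₜ X) (hmin : IsMinimalHomeo h)
    (α : C(X, D) ≃⋆ₐ[ℂ] C(X, D)) (hα : LiesOver h α)
    (hper : IsPseudoperiodicallyGenerated h α)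
    (Y : Set X) (hY : IsCompact Y)
    (hYdisj : ∀ n : ℤ, n ≠ 0 → (h ^ n) '' Y ∩ Y = ∅) :
    IsLargeOfCrossedProductType (orbitBreaking α Y) := by
  have hd : ∀ n : ℤ, n ≠ 0 → ∀ y ∈ Y, (h ^ n) y ∉ Y := fun n hn y hy hy' =>
    (Set.eq_empty_iff_forall_notMem.1 (hYdisj n hn)) _ ⟨⟨y, hy, rfl⟩, hy'⟩
  obtain ⟨x₀, hx₀⟩ := hmin.exists_orbit_notMem hY hd
  obtain ⟨i, hi⟩ := hτ.exists_covariantPair hα x₀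
  have hDnt : Nontrivial D := hD.1
  -- The tracial state provides a covariant pair, so the crossed product is nonzero.
  have hnt : Nontrivial (CrossedProduct α) := ⟨1, 0, fun h01 => one_ne_zero (α := i.E) (by
    rw [← map_one (CrossedProduct.evalHom i), h01, map_zero])⟩
  set R := CrossedProduct.rep α with hR
  have hι : Function.Injective R.ι := R.ι_injective hD hmin hper
  have hco : R.HasCoeffs h := CrossedProduct.hasCoeffs hα hι
  have hsimple : IsSimpleCStar (CrossedProduct α) := hco.isSimple hD hmin hper
  have hB : R.Breaks Y (orbitBreaking α Y) := breaks_orbitBreaking Y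
  refine ⟨hsimple, R.not_finiteDimensional hι, hB.isClosed, R.ι.range, {(R.U : CrossedProduct α)},
    ?_, ?_, ?_, ?_, ?_, ?_⟩
  · exact (NonUnitalStarAlgHom.isometry R.ι hι).isClosedEmbedding.isClosed_range
  · rintro _ ⟨f, rfl⟩
    exact hB.ι_mem f
  · rintro _ rfl
    exact R.U.2
  · exact CrossedProduct.cstarGenerated_eq_top α (fun f => Or.inl ⟨f, rfl⟩) (Or.inr rfl)
  · rintro _ rfl _ ⟨f, rfl⟩
    have := R.U_mul_ι_mul_star f
    exact ⟨⟨_, this.1.symm⟩, ⟨_, this.2.symm⟩⟩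
  intro m a ε x y _ hε hx hx1 hyB hy hy0
  choose c hc hca using fun j => Metric.mem_closure_iff.1
    (CrossedProduct.mem_closure_polys α (a j)) ε hε
  choose N hN using fun j => hB.exists_scalar_mul_mem hα (hc j)
  have hx0 : x ≠ 0 := fun h0 => by simp [h0] at hx1
  obtain ⟨φ, d, hφ, hφ0, hd1, hd0, hφy⟩ :=
    hco.exists_cuntzSubeq hmin hB.isClosed hB.ι_mem hyB hy hy0
  obtain ⟨φ', d', hφ', hφ0', hd1', hd0', hφx⟩ := hco.exists_cuntzSubeq hmin (B := ⊤)
    (by simp) (fun _ => trivial) trivial hx hx0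
  obtain ⟨V, hV, hxV, hVc⟩ := hB.exists_nhd_scalar_cuntzSubeq hD hmin hper hY.isClosed hx₀
    hφ hφ0 hd1 hd0
  obtain ⟨V', hV', hxV', hVc'⟩ := R.breaks_empty_top.exists_nhd_scalar_cuntzSubeq hD hmin hper
    isClosed_empty (x₀ := x₀) (fun _ => id) hφ' hφ0' hd1' hd0'
  -- One bump function serves both comparisons: through `V` it lies below `y` over `B`, through `V'`
  -- below `x` over the whole algebra.
  obtain ⟨G, hG0, -, hGV, W, hW, hxW, hGW⟩ := exists_bump (hV.inter hV') ⟨hxV, hxV'⟩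
  obtain ⟨S, hS⟩ := hi (CrossedProduct.evalHom i x) ε hε
  obtain ⟨g, hg0, hg1, hgS, hgY, hgG⟩ := hB.exists_scalar_cuntzSubeq hα hmin hY hd hx₀ hW hxW
    hGW (Finset.univ.sup N) S
  have hg1' : 0 ≤ 1 - g := sub_nonneg.2 (show g ≤ 1 from hg1)
  have h1g : 1 - R.scalar g = R.scalar (1 - g) := by simp [CovariantRep.scalar]
  refine ⟨c, R.scalar g, ⟨_, rfl⟩, (isPosElem_scalarMap hg0).map R.ι, ?_, fun j => ?_,
    fun j => ?_, ?_, ?_, ?_⟩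
  · rw [h1g]
    exact (isPosElem_scalarMap hg1').map R.ι
  · rw [← dist_eq_norm, dist_comm]
    exact hca j
  · rw [h1g]
    refine hN j _ hg1' fun l hl1 hl2 y hy => ?_
    have hNj : N j ≤ Finset.univ.sup N := Finset.le_sup (Finset.mem_univ j)
    simp [hgY l (by omega) (by omega) y hy]
  · exact (hgG.trans (hVc G hG0 fun x hx => hGV x fun hx' => hx hx'.1)).trans hφy
  · exact ((hgG.mono le_top).trans (hVc' G hG0 fun x hx => hGV x fun hx' => hx hx'.2)).trans hφx
  -- Simplicity makes the regular representation isometric, so the norm estimate obtained there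
  -- holds in the crossed product.
  · have hinj := hsimple.injective (CrossedProduct.evalHom i)
    have := hS g hg0 hg1 hgS
    rw [NonUnitalStarAlgHom.norm_map (CrossedProduct.evalHom i) hinj, hx1,
      ← CrossedProduct.evalHom_ι, ← map_one (CrossedProduct.evalHom i), ← map_sub, ← map_mul,
      ← map_mul, NonUnitalStarAlgHom.norm_map (CrossedProduct.evalHom i) hinj] at this
    exact this
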